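/- Let $n\ge 2$, $N\ge 1$ and $\alpha\in(0,1]$. Let $X\subset\mathbb R^n$ be compact, $Y=\{y_1,\dots,y_N\}\subset\mathbb R^n$, and let $c:X\times Y\to\mathbb R$ satisfy $c(\cdot,y_i)\in C^2(X)$ for all $i$ and $\nabla_xc(x,y_i)\ne\nabla_xc(x,y_k)$ for all $x\in X$, $i\ne k$. For each $i$ let $\exp_i:X_i\to X$ be a $C^2$ diffeomorphism from a convex set $X_i\subset\mathbb R^n$ onto $X$. Let $\mu=\rho\,dx$ be a probability measure on $X$ with density $0\le\rho\in C^{0,\alpha}(X)$. For $\psi\in\mathbb R^N$ let $$\mathrm{Lag}_i(\psi)=\{x\in X: -c(x,y_i)-\psi^i=\max_j(-c(x,y_j)-\psi^j)\},\qquad G(\psi)=(\mu(\mathrm{Lag}_1(\psi)),\dots,\mu(\mathrm{Lag}_N(\psi))),$$ and for $\lambda\in\mathbb R^N$ let $$\mathcal C(\lambda)=\inf\Big\{\int_X c(x,T(x))\,d\mu(x)\ :\ T:X\to Y\text{ measurable},\ T_\#\mu=\sum_{i=1}^N\lambda^i\delta_{y_i}\Big\}\in\mathbb R\cup\{+\infty\},$$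 with $\mathcal C(\lambda)=+\infty$ if there is no such $T$. Norms on $\mathbb R^n$ and $\mathbb R^N$ are Euclidean, and $[\,\cdot\,]_{C^{0,1}}$ is the Lipschitz seminorm. A positive constant is called universal if it depends only on $\alpha$, $n$, $N$, $\|\rho\|_{C^{0,\alpha}(X)}$, $\mathcal H^{n-1}(\partial X)$, $\max_i\|c(\cdot,y_i)\|_{C^2(X)}$, $\min_{x\in X,\,i\ne j}\|\nabla_xc(x,y_i)-\nabla_xc(x,y_j)\|$, $\max_{x\in X,\,i}\|\nabla_xc(x,y_i)\|$, $\max_i\max\{\|\exp_i\|_{C^{0,1}(X_i)},\|\exp_i^{-1}\|_{C^{0,1}(X)}\}$, $\max_{i}\max_{p\in X_i}\mathrm{cond}(D\exp_i(p))$ and $\max_i\|\det D\exp_i\|_{C^{0,1}(X_i)}$. There is a universal constant $C_L>0$ such that $[G]_{C^{0,1}(\mathbb R^N)}\le C_LN$. Moreover, for this $C_L$, and in fact for every $C_L>0$ with $[G]_{C^{0,1}(\mathbb R^N)}\le C_LN$, the following hold. 1. $\mathcal C$ is strongly convex: for all $x,z\in\mathbb R^N$ and $t\in[0,1]$ (with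 the convention $0\cdot(+\infty)=0$), $$t\,\mathcal C(x)+(1-t)\,\mathcal C(z)\ \ge\ \mathcal C(tx+(1-t)z)+\frac{1}{8C_LN}\,t(1-t)\,\|z-x\|^2 .$$ 2. If $K$ is a convex subset of the domain $\{\mathcal C<+\infty\}$ and $\lambda_{\min}\in K$ minimizes $\mathcal C$ over $K$, then for all $\lambda\in K$ $$\mathcal C(\lambda)-\mathcal C(\lambda_{\min})\ \ge\ \frac{1}{32C_LN}\,\|\lambda-\lambda_{\min}\|^2 .$$ -/

import Mathlib

open MeasureTheory Set
open scoped ENNReal NNReal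

noncomputable section

/-- Real `n`-space with the Euclidean norm. -/
abbrev RealSpace (n : ℕ) : Type := EuclideanSpace ℝ (Fin n)

/-! ### Laguerre cells and the optimal transport cost -/

/-- The `c*`-transform `x ↦ max_i (-c(x, y_i) - ψ^i)` of a vector `ψ` (a maximum over the finite
nonempty index set `Fin N`). -/
def cStarTransform {n N : ℕ} (y : Fin N → RealSpace n) (c : RealSpace n → RealSpace n → ℝ)
    (ψ : RealSpace N) (x : RealSpace n) : ℝ :=
  ⨆ i : Fin N, (-c x (y i) - ψ i)

/-- The `i`-th Laguerre cell of `ψ`. -/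
def laguerreCell {n N : ℕ} (X : Set (RealSpace n)) (y : Fin N → RealSpace n)
    (c : RealSpace n → RealSpace n → ℝ) (ψ : RealSpace N) (i : Fin N) : Set (RealSpace n) :=
  {x | x ∈ X ∧ -c x (y i) - ψ i = cStarTransform y c ψ x}

/-- The vector `G(ψ)` of the `μ`-masses of the Laguerre cells of `ψ`. -/
def cellMass {n N : ℕ} (μ : Measure (RealSpace n)) (X : Set (RealSpace n))
    (y : Fin N → RealSpace n) (c : RealSpace n → RealSpace n → ℝ) (ψ : RealSpace N) :
    RealSpace N :=
  WithLp.toLp 2 (fun i => μ.real (laguerreCell X y c ψ i))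

/-- `T` is a measurable map carrying `X` into `Y = {y_1, …, y_N}` which pushes `μ` forward to
`∑ i, lam^i δ_{y_i}`. (The weights are required to be nonnegative because `ENNReal.ofReal`
truncates; that they sum to `1` is forced by the mass of `μ`.) -/
structure IsTransportMap {n N : ℕ} (μ : Measure (RealSpace n)) (X : Set (RealSpace n))
    (y : Fin N → RealSpace n) (lam : RealSpace N) (T : RealSpace n → RealSpace n) : Prop where
  measurable : Measurable T
  mapsTo : MapsTo T X (range y)
  nonneg : ∀ i, 0 ≤ lam i
  map_eq : μ.map T = ∑ i : Fin N, ENNReal.ofReal (lam i) • Measure.dirac (y i)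

/-- The optimal transport cost `C(lam)` from `μ` to `∑ i, lam^i δ_{y_i}`, as an extended real
valued function on the whole space of weight vectors: it is `+∞` when there is no transport map,
in particular off the standard simplex. -/
def transportCost {n N : ℕ} (μ : Measure (RealSpace n)) (X : Set (RealSpace n))
    (y : Fin N → RealSpace n) (c : RealSpace n → RealSpace n → ℝ) (lam : RealSpace N) : EReal :=
  ⨅ T : {T : RealSpace n → RealSpace n // IsTransportMap μ X y lam T},
    ((∫ x in X, c x (T.1 x) ∂μ : ℝ) : EReal)

/-! ### Standing assumptions -/

/-- `e : D → X` is a `C²` diffeomorphism with inverse `e' : X → D` (derivatives being taken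
within `D` and within `X`). -/
structure IsC2Diffeo {n : ℕ} (e e' : RealSpace n → RealSpace n) (D X : Set (RealSpace n)) :
    Prop where
  mapsTo : MapsTo e D X
  mapsTo_inv : MapsTo e' X D
  invOn : InvOn e' e D X
  contDiffOn : ContDiffOn ℝ 2 e D
  contDiffOn_inv : ContDiffOn ℝ 2 e' X

/-- The gradient of `c(·, y_i)` at a point `x` of `X`. -/
def costGradient {n N : ℕ} (X : Set (RealSpace n)) (y : Fin N → RealSpace n)
    (c : RealSpace n → RealSpace n → ℝ) (i : Fin N) (x : RealSpace n) : RealSpace n :=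
  gradientWithin (fun z => c z (y i)) X x

/-! ### The quantities that a universal constant may depend on -/

/-- The `C²` norm of `f` on `X`: the sum of the suprema of the norms of `f`, `Df` and `D²f`. -/
def c2Norm {n : ℕ} (f : RealSpace n → ℝ) (X : Set (RealSpace n)) : ℝ≥0∞ :=
  ∑ k ∈ Finset.range 3, ⨆ x ∈ X, ‖iteratedFDerivWithin ℝ k f X x‖ₑ

/-- The Hölder norm `‖f‖_{C^{0,α}(A)}`: supremum norm plus Hölder seminorm on `A`. For `α = 1`
it is the Lipschitz norm. -/
def holderNormOn {n : ℕ} {F : Type} [NormedAddCommGroup F] (α : ℝ≥0) (f : RealSpace n → F)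
    (A : Set (RealSpace n)) : ℝ≥0∞ :=
  (⨆ x ∈ A, ‖f x‖ₑ) + eHolderNorm α (A.domRestrict f)

/-- The condition number of an (invertible) linear map. -/
def condNumber {n : ℕ} (A : RealSpace n →L[ℝ] RealSpace n) : ℝ≥0∞ :=
  ‖A‖ₑ * ‖A.inverse‖ₑ

/-- Values of the quantities, other than `α`, `n` and `N`, on which a universal constant may
depend. -/
structure UniversalQuantities where
  rhoNorm : ℝ≥0∞
  boundaryArea : ℝ≥0∞
  costNorm : ℝ≥0∞
  epsTwist : ℝ≥0∞
  gradBound : ℝ≥0∞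
  expLip : ℝ≥0∞
  expCond : ℝ≥0∞
  expDet : ℝ≥0∞

/-- The quantities `‖ρ‖_{C^{0,α}(X)}`, `H^{n-1}(∂X)`, `max_i ‖c(·, y_i)‖_{C²(X)}`, `ε_tw`, `C_∇`,
`C_exp`, `C_cond`, `C_det` of a given problem; `e i : D i → X` are the coordinate
diffeomorphisms `exp_i` and `e' i` their inverses. -/
def universalQuantities {n N : ℕ} (α : ℝ≥0) (X : Set (RealSpace n)) (y : Fin N → RealSpace n)
    (c : RealSpace n → RealSpace n → ℝ) (D : Fin N → Set (RealSpace n))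
    (e e' : Fin N → RealSpace n → RealSpace n) (ρ : RealSpace n → ℝ) : UniversalQuantities where
  rhoNorm := holderNormOn α ρ X
  boundaryArea := Measure.hausdorffMeasure ((n : ℝ) - 1) (frontier X)
  costNorm := ⨆ i, c2Norm (fun x => c x (y i)) X
  epsTwist := ⨅ x ∈ X, ⨅ i : Fin N, ⨅ j : Fin N, ⨅ _ : i ≠ j,
    ‖costGradient X y c i x - costGradient X y c j x‖ₑ
  gradBound := ⨆ x ∈ X, ⨆ i : Fin N, ‖costGradient X y c i x‖ₑ
  expLip := ⨆ i, max (holderNormOn 1 (e i) (D i)) (holderNormOn 1 (e' i) X)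
  expCond := ⨆ i, ⨆ p ∈ D i, condNumber (fderivWithin ℝ (e i) (D i) p)
  expDet := ⨆ i, holderNormOn 1 (fun p => (fderivWithin ℝ (e i) (D i) p).det) (D i)

end

/-! ### Measurable choice of a Laguerre cell, and weak duality for assignments. -/

section Selection

variable {n N : ℕ} {μ : Measure (RealSpace n)} {X : Set (RealSpace n)} {y : Fin N → RealSpace n}
  {c : RealSpace n → RealSpace n → ℝ}

/-! Let Φ(ψ) be the μ-integral of max_i(-c(x, y_i) - ψ^i) (`dualPotential`). It is convex with
gradient -G, and by Kantorovich duality the cost is its Legendre transform: C(λ) = sup_ψ (-Φ(ψ) -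
⟨λ, ψ⟩). A convex function with Lipschitz gradient has a strongly convex conjugate, so both
convexity claims follow from a Lipschitz bound on G.

Full duality is not needed. Weak duality bounds C from below, the assignment by Laguerre cells gives
equality at λ = G(ψ), and `exists_cellMass_eq` shows that G maps onto the simplex. Together they put
a paraboloid of curvature 1/(4L) under C at each point of the simplex
(`exists_supporting_paraboloid`), where L is any positive Lipschitz constant of G. Averaging the
paraboloid based at tx + (1-t)z gives strong convexity; the midpoint case gives quadratic growth.

For the Lipschitz bound, a point that leaves cell i when ψ becomes ψ' must lie, for some j, in a
strip where c(·, y_i) - c(·, y_j) varies by at most 2‖ψ - ψ'‖. Hence it suffices that strips of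
width δ have mass O(δ) (`StripBound`). By the twist condition this difference has gradient of norm
at least ε > 0, so in small balls it is nearly affine and a strip cannot contain two points far
apart along the gradient; a packing of disjoint translates then bounds its volume
(`exists_volume_slab_le`). Since X need not be convex, the Taylor estimate runs along images of
segments under exp_i. Ball radius, number of balls and translation step depend only on the admitted
quantities and δ, which makes the constant universal. -/

theorem neg_cost_sub_le_cStarTransform (ψ : RealSpace N) (x : RealSpace n) (i : Fin N) :
    -c x (y i) - ψ i ≤ cStarTransform y c ψ x :=
  le_ciSup (f := fun i => -c x (y i) - ψ i) (Set.finite_range _).bddAbove i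

theorem exists_eq_cStarTransform [NeZero N] (ψ : RealSpace N) (x : RealSpace n) :
    ∃ i, -c x (y i) - ψ i = cStarTransform y c ψ x :=
  exists_eq_ciSup_of_finite (f := fun i => -c x (y i) - ψ i)

theorem cStarTransform_le [NeZero N] {ψ : RealSpace N} {x : RealSpace n} {a : ℝ}
    (h : ∀ i, -c x (y i) - ψ i ≤ a) : cStarTransform y c ψ x ≤ a :=
  ciSup_le h

theorem continuousOn_cStarTransform [NeZero N] (hc : ∀ i, ContinuousOn (fun x => c x (y i)) X)
    (ψ : RealSpace N) : ContinuousOn (cStarTransform y c ψ) X := by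
  have : cStarTransform y c ψ =
      fun x => Finset.univ.sup' Finset.univ_nonempty fun i : Fin N => -c x (y i) - ψ i := by
    funext x
    rw [Finset.sup'_univ_eq_ciSup]; rfl
  rw [this]
  exact ContinuousOn.finset_sup'_apply _ fun i _ => (hc i).neg.sub continuousOn_const

theorem measurableSet_laguerreCell [NeZero N] (hX : IsCompact X)
    (hc : ∀ i, ContinuousOn (fun x => c x (y i)) X) (ψ : RealSpace N) (i : Fin N) :
    MeasurableSet (laguerreCell X y c ψ i) := by
  have h := ContinuousOn.preimage_isClosed_of_isClosed
    (((hc i).neg.sub continuousOn_const).sub (continuousOn_cStarTransform hc ψ)) hX.isClosed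
    (isClosed_singleton (x := (0 : ℝ))) (f := fun x => -c x (y i) - ψ i - cStarTransform y c ψ x)
  convert h.measurableSet using 1
  ext x
  simp [laguerreCell, sub_eq_zero]

/-- Ties on cell boundaries are broken by taking the least index. -/
theorem exists_measurable_selection [NeZero N] (hX : IsCompact X)
    (hc : ∀ i, ContinuousOn (fun x => c x (y i)) X) (ψ : RealSpace N) :
    ∃ s : RealSpace n → Fin N, Measurable s ∧ ∀ x ∈ X, x ∈ laguerreCell X y c ψ (s x) := by
  classical
  -- The alternative `x ∉ X` makes the search total; it returns 0 off X.
  have hfind : ∀ x, ∃ k : ℕ, x ∉ X ∨ ∃ h : k < N, x ∈ laguerreCell X y c ψ ⟨k, h⟩ := by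
    intro x
    by_cases hx : x ∈ X
    · obtain ⟨i, hi⟩ := exists_eq_cStarTransform (y := y) (c := c) ψ x
      exact ⟨i, Or.inr ⟨i.2, hx, hi⟩⟩
    · exact ⟨0, Or.inl hx⟩
  have hm : Measurable fun x => Nat.find (hfind x) := by
    refine measurable_find hfind fun k => ?_
    refine MeasurableSet.union hX.measurableSet.compl ?_
    change MeasurableSet {x | ∃ h : k < N, x ∈ laguerreCell X y c ψ ⟨k, h⟩}
    by_cases h : k < N
    · simpa only [h, exists_true_left, ofPred_mem_eq] using
        measurableSet_laguerreCell hX hc ψ ⟨k, h⟩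
    · simp [h]
  refine ⟨fun x => Fin.ofNat N (Nat.find (hfind x)),
    (measurable_of_countable (Fin.ofNat N)).comp hm, fun x hx => ?_⟩
  rcases Nat.find_spec (hfind x) with h | ⟨h, h'⟩
  · exact absurd hx h
  · have : Fin.ofNat N (Nat.find (hfind x)) = ⟨_, h⟩ := Fin.ext (Nat.mod_eq_of_lt h)
    simpa only [this] using h'

theorem integrable_comp_selection [IsFiniteMeasure μ] {s : RealSpace n → Fin N}
    (hs : Measurable s) (a : Fin N → ℝ) : Integrable (fun x => a (s x)) μ := by
  refine Integrable.comp_measurable (g := a) ?_ hs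
  exact Integrable.of_finite

theorem integral_comp_selection [IsFiniteMeasure μ] {s : RealSpace n → Fin N}
    (hs : Measurable s) (a : Fin N → ℝ) : ∫ x, a (s x) ∂μ = ∑ i, μ.real (s ⁻¹' {i}) * a i := by
  rw [← integral_map hs.aemeasurable (f := a) Measurable.of_discrete.aestronglyMeasurable,
    integral_fintype Integrable.of_finite]
  refine Finset.sum_congr rfl fun i _ => ?_
  rw [map_measureReal_apply hs (measurableSet_singleton i), smul_eq_mul]

theorem integrableOn_cost_selection [IsFiniteMeasure μ] (hX : IsCompact X)
    (hc : ∀ i, ContinuousOn (fun x => c x (y i)) X) {s : RealSpace n → Fin N}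
    (hs : Measurable s) : IntegrableOn (fun x => c x (y (s x))) X μ := by
  classical
  have : (fun x => c x (y (s x))) =
      fun x => ∑ i, (s ⁻¹' {i}).indicator (fun x => c x (y i)) x := by
    funext x
    simp [Set.indicator_apply]
  rw [this]
  refine integrable_finsetSum _ fun i _ => ?_
  exact ((hc i).integrableOn_compact hX).indicator (hs (measurableSet_singleton i))

/-- The integral of the `c*`-transform, as a function of the potential. -/
noncomputable def dualPotential (μ : Measure (RealSpace n)) (X : Set (RealSpace n)) (y : Fin N → RealSpace n)
    (c : RealSpace n → RealSpace n → ℝ) (ψ : RealSpace N) : ℝ :=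
  ∫ x in X, cStarTransform y c ψ x ∂μ

theorem integral_neg_cost_selection [IsFiniteMeasure μ] (hX : IsCompact X)
    (hc : ∀ i, ContinuousOn (fun x => c x (y i)) X) (hμX : μ.restrict X = μ)
    {s : RealSpace n → Fin N} (hs : Measurable s) (ψ : RealSpace N) :
    ∫ x in X, (-c x (y (s x)) - ψ (s x)) ∂μ =
      -(∫ x in X, c x (y (s x)) ∂μ) - ∑ i, μ.real (s ⁻¹' {i}) * ψ i := by
  rw [integral_sub (integrableOn_cost_selection hX hc hs).fun_neg
    (integrable_comp_selection hs (fun i => ψ i)), integral_neg]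
  congr 1
  rw [hμX]
  exact integral_comp_selection hs _

/-- Weak duality for an arbitrary measurable assignment. -/
theorem neg_cost_selection_le_dualPotential [NeZero N] [IsFiniteMeasure μ] (hX : IsCompact X)
    (hc : ∀ i, ContinuousOn (fun x => c x (y i)) X) (hμX : μ.restrict X = μ)
    {s : RealSpace n → Fin N} (hs : Measurable s) (ψ : RealSpace N) :
    -(∫ x in X, c x (y (s x)) ∂μ) - ∑ i, μ.real (s ⁻¹' {i}) * ψ i ≤
      dualPotential μ X y c ψ := by
  rw [← integral_neg_cost_selection hX hc hμX hs]
  refine integral_mono ?_ ((continuousOn_cStarTransform hc ψ).integrableOn_compact hX) ?_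
  · exact (integrableOn_cost_selection hX hc hs).neg.sub
      (integrable_comp_selection hs (fun i => ψ i))
  · exact fun x => neg_cost_sub_le_cStarTransform ψ x _

theorem neg_cost_selection_eq_dualPotential [IsFiniteMeasure μ] (hX : IsCompact X)
    (hc : ∀ i, ContinuousOn (fun x => c x (y i)) X) (hμX : μ.restrict X = μ)
    {s : RealSpace n → Fin N} (hs : Measurable s) {ψ : RealSpace N}
    (hsψ : ∀ x ∈ X, x ∈ laguerreCell X y c ψ (s x)) :
    -(∫ x in X, c x (y (s x)) ∂μ) - ∑ i, μ.real (s ⁻¹' {i}) * ψ i =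
      dualPotential μ X y c ψ := by
  rw [← integral_neg_cost_selection hX hc hμX hs]
  exact setIntegral_congr_fun hX.measurableSet fun x hx => (hsψ x hx).2

/-- The tie-breaking rule is invisible to μ because overlaps of cells are null. -/
theorem measureReal_selection (hμX : μ.restrict X = μ) {ψ : RealSpace N}
    (hdis : ∀ i j, i ≠ j → μ (laguerreCell X y c ψ i ∩ laguerreCell X y c ψ j) = 0)
    (hX : MeasurableSet X)
    {s : RealSpace n → Fin N} (hsψ : ∀ x ∈ X, x ∈ laguerreCell X y c ψ (s x)) (i : Fin N) :
    μ.real (s ⁻¹' {i}) = cellMass μ X y c ψ i := by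
  refine measureReal_congr ?_
  have h1 : ∀ᵐ x ∂μ, x ∈ X := by rw [← hμX]; exact ae_restrict_mem hX
  have h2 : ∀ᵐ x ∂μ, ∀ j, i ≠ j → x ∉ laguerreCell X y c ψ i ∩ laguerreCell X y c ψ j := by
    rw [ae_all_iff]
    intro j
    by_cases hij : i = j
    · simp [hij]
    · simpa [hij] using measure_eq_zero_iff_ae_notMem.1 (hdis i j hij)
  filter_upwards [h1, h2] with x hx hx2
  refine propext ⟨fun h => ?_, fun h => ?_⟩
  · have h : s x = i := h
    exact h ▸ hsψ x hx
  · by_contra hne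
    exact hx2 (s x) (fun h => hne h.symm) ⟨h, hsψ x hx⟩

end Selection

/-! ### Kantorovich duality and strong convexity of the conjugate. -/

section Duality

variable {n N : ℕ} {μ : Measure (RealSpace n)} {X : Set (RealSpace n)} {y : Fin N → RealSpace n}
  {c : RealSpace n → RealSpace n → ℝ}

theorem real_inner_eq_sum (u v : RealSpace N) : inner ℝ u v = ∑ i, u i * v i := by
  rw [PiLp.inner_apply]
  exact Finset.sum_congr rfl fun i _ => by simp [mul_comm]

/-- Any two Laguerre cells of any potential overlap in a null set. -/
def CellsAEDisjoint (μ : Measure (RealSpace n)) (X : Set (RealSpace n)) (y : Fin N → RealSpace n)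
    (c : RealSpace n → RealSpace n → ℝ) : Prop :=
  ∀ ψ : RealSpace N, ∀ i j, i ≠ j → μ (laguerreCell X y c ψ i ∩ laguerreCell X y c ψ j) = 0

variable [NeZero N] [IsProbabilityMeasure μ] (hX : IsCompact X)
  (hc : ∀ i, ContinuousOn (fun x => c x (y i)) X) (hμX : μ.restrict X = μ)
  (hdis : CellsAEDisjoint μ X y c)

include hX hc hμX hdis

/-- The subgradient inequality, with -G as gradient: the assignment optimal for ψ is only a
competitor for ψ'. -/
theorem dualPotential_sub_inner_le (ψ ψ' : RealSpace N) :
    dualPotential μ X y c ψ - inner ℝ (cellMass μ X y c ψ) (ψ' - ψ) ≤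
      dualPotential μ X y c ψ' := by
  obtain ⟨s, hs, hsψ⟩ := exists_measurable_selection hX hc ψ
  have h1 := neg_cost_selection_le_dualPotential hX hc hμX hs ψ'
  have h2 := neg_cost_selection_eq_dualPotential hX hc hμX hs hsψ
  simp only [measureReal_selection hμX (hdis ψ) hX.measurableSet hsψ] at h1 h2
  rw [inner_sub_right, real_inner_eq_sum, real_inner_eq_sum]
  linarith

/-- Apply the subgradient inequality at ψ' and exchange G(ψ') for G(ψ) by the Lipschitz bound.
Integrating along the segment would give L/2; the cruder L still suffices for the constants claimed.
-/
theorem dualPotential_le {L : ℝ≥0} (hL : LipschitzWith L (cellMass μ X y c))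
    (ψ ψ' : RealSpace N) :
    dualPotential μ X y c ψ' ≤ dualPotential μ X y c ψ
      - inner ℝ (cellMass μ X y c ψ) (ψ' - ψ) + L * ‖ψ' - ψ‖ ^ 2 := by
  have h := dualPotential_sub_inner_le hX hc hμX hdis ψ' ψ
  have h1 : inner ℝ (cellMass μ X y c ψ - cellMass μ X y c ψ') (ψ' - ψ) ≤
      L * ‖ψ' - ψ‖ ^ 2 := by
    refine (real_inner_le_norm _ _).trans ?_
    have := hL.norm_sub_le ψ ψ'
    rw [norm_sub_rev ψ ψ'] at this
    nlinarith [norm_nonneg (ψ' - ψ)]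
  have h2 : inner ℝ (cellMass μ X y c ψ') (ψ - ψ') =
      - inner ℝ (cellMass μ X y c ψ') (ψ' - ψ) := by
    rw [← inner_neg_right, neg_sub]
  rw [inner_sub_left] at h1
  linarith

theorem continuous_dualPotential : Continuous (dualPotential μ X y c) := by
  refine (LipschitzWith.of_le_add_mul (N : ℝ≥0) fun ψ ψ' => ?_).continuous
  have h := dualPotential_sub_inner_le hX hc hμX hdis ψ ψ'
  have h1 : inner ℝ (cellMass μ X y c ψ) (ψ' - ψ) ≤ N * dist ψ ψ' := by
    rw [real_inner_eq_sum, dist_comm, dist_eq_norm]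
    refine (Finset.sum_le_card_nsmul _ _ ‖ψ' - ψ‖ fun i _ => ?_).trans (by simp)
    have h3 : cellMass μ X y c ψ i ≤ 1 := measureReal_le_one
    have h4 : 0 ≤ cellMass μ X y c ψ i := measureReal_nonneg
    have h5 := PiLp.norm_apply_le (ψ' - ψ) i
    rw [Real.norm_eq_abs] at h5
    have h6 := le_abs_self ((ψ' - ψ) i)
    nlinarith [norm_nonneg (ψ' - ψ)]
  simp only [NNReal.coe_natCast]
  linarith

/-- Every point of the standard simplex is attained by the vector of cell masses. -/
theorem exists_cellMass_eq {L : ℝ≥0} (hL0 : 0 < L) (hL : LipschitzWith L (cellMass μ X y c))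
    {w : RealSpace N} (hw : ∀ i, 0 ≤ w i) (hw1 : ∑ i, w i = 1) :
    ∃ ψ, cellMass μ X y c ψ = w := by
  obtain ⟨M, hM⟩ : ∃ M, ∀ x ∈ X, ∀ i, |c x (y i)| ≤ M := by
    choose M hM using fun i => hX.exists_bound_of_continuousOn (hc i)
    refine ⟨∑ i, |M i|, fun x hx i => (hM i x hx).trans ((le_abs_self _).trans ?_)⟩
    exact Finset.single_le_sum (f := fun i => |M i|) (fun i _ => abs_nonneg _)
      (Finset.mem_univ i)
  have hμ1 : μ.real X = 1 := by
    have : μ.real X = (μ.restrict X).real univ := by simp [measureReal_def]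
    rw [this, hμX, probReal_univ]
  have hXne : X.Nonempty := by
    by_contra h
    rw [not_nonempty_iff_eq_empty.1 h] at hμ1
    simp [measureReal_def] at hμ1
  have hM0 : 0 ≤ M := by
    obtain ⟨x, hx⟩ := hXne
    exact (abs_nonneg _).trans (hM x hx 0)
  set H : RealSpace N → ℝ := fun ψ => dualPotential μ X y c ψ + inner ℝ w ψ with hH
  have hHc : Continuous H :=
    (continuous_dualPotential hX hc hμX hdis).add (continuous_const.inner continuous_id)
  -- H is invariant under adding constants to ψ, so the least coordinate may be taken to be 0. As
  -- costs differ by at most 2M, an index with coordinate above 2M never beats that one, and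
  -- truncating at 2M does not increase H.
  set B : Set (RealSpace N) := WithLp.toLp 2 '' (univ.pi fun _ => Icc 0 (2 * M)) with hB
  have hBc : IsCompact B :=
    (isCompact_univ_pi fun _ => isCompact_Icc).image (PiLp.continuous_toLp 2 _)
  have hBne : B.Nonempty := by
    refine Nonempty.image _ ⟨0, fun i _ => ⟨le_rfl, ?_⟩⟩
    simpa using hM0
  obtain ⟨ψ, -, hψ⟩ := hBc.exists_isMinOn hBne hHc.continuousOn
  have hmin : ∀ φ, H ψ ≤ H φ := by
    intro φ
    obtain ⟨i₀, hi₀⟩ := Finite.exists_min (fun i => φ i)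
    set m := φ i₀
    set φ' : RealSpace N := WithLp.toLp 2 fun i => min (φ i - m) (2 * M) with hφ'
    have hmem : φ' ∈ B := by
      refine mem_image_of_mem _ fun i _ => ⟨le_min ?_ (by linarith), min_le_right _ _⟩
      linarith [hi₀ i]
    refine (hψ hmem).trans ?_
    have h1 : dualPotential μ X y c φ' ≤ dualPotential μ X y c φ + m := by
      have : dualPotential μ X y c φ + m = ∫ x in X, (cStarTransform y c φ x + m) ∂μ := by
        rw [integral_add ((continuousOn_cStarTransform hc φ).integrableOn_compact hX)
          (integrable_const _), setIntegral_const, hμ1, one_smul]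
        rfl
      rw [this]
      refine setIntegral_mono_on ((continuousOn_cStarTransform hc φ').integrableOn_compact hX)
        (((continuousOn_cStarTransform hc φ).add continuousOn_const).integrableOn_compact hX)
        hX.measurableSet fun x hx => cStarTransform_le fun i => ?_
      change -c x (y i) - min (φ i - m) (2 * M) ≤ _
      have hi := neg_cost_sub_le_cStarTransform (y := y) (c := c) φ x i
      have hi' := neg_cost_sub_le_cStarTransform (y := y) (c := c) φ x i₀
      have b1 := abs_le.1 (hM x hx i)
      have b2 := abs_le.1 (hM x hx i₀)
      rcases min_choice (φ i - m) (2 * M) with h | h <;> rw [h]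
      · linarith
      · change _ - m ≤ _ at hi'
        linarith [b1.1, b2.2]
    have h2 : inner ℝ w φ' ≤ inner ℝ w φ - m := by
      have : inner ℝ w φ - m = ∑ i, w i * (φ i - m) := by
        simp only [mul_sub, Finset.sum_sub_distrib, ← Finset.sum_mul, hw1, one_mul]
        rw [real_inner_eq_sum]
      rw [this, real_inner_eq_sum]
      exact Finset.sum_le_sum fun i _ => mul_le_mul_of_nonneg_left (min_le_left _ _) (hw i)
    simp only [hH]
    linarith
  refine ⟨ψ, ?_⟩
  set d := w - cellMass μ X y c ψ with hd
  have hLpos : (0 : ℝ) < L := hL0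
  -- Here d is the gradient of H at ψ. A gradient step of length a changes H by at most (-a +
  -- La²)‖d‖², which is least at this a; minimality of ψ forces d = 0.
  set a : ℝ := 1 / (2 * L) with ha
  have h1 := hmin (ψ - a • d)
  have h2 := dualPotential_le hX hc hμX hdis hL ψ (ψ - a • d)
  have h3 : inner ℝ w (ψ - a • d) = inner ℝ w ψ - a * inner ℝ w d := by
    rw [inner_sub_right, inner_smul_right]
  have h4 : ψ - a • d - ψ = -(a • d) := by abel
  have h5 : inner ℝ w d - inner ℝ (cellMass μ X y c ψ) d = ‖d‖ ^ 2 := by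
    rw [← inner_sub_left, ← hd, real_inner_self_eq_norm_sq]
  rw [h4, inner_neg_right, inner_smul_right, norm_neg, norm_smul, mul_pow, Real.norm_eq_abs,
    sq_abs] at h2
  simp only [hH] at h1
  have h6 : a * ‖d‖ ^ 2 ≤ L * (a ^ 2 * ‖d‖ ^ 2) := by
    rw [← h5]
    rw [← h5] at h2
    linarith
  have h7 : L * (a ^ 2 * ‖d‖ ^ 2) = a * ‖d‖ ^ 2 / 2 := by
    rw [ha]; field_simp
  have h8 : ‖d‖ ^ 2 ≤ 0 := by
    have : 0 < a := by positivity
    rw [h7] at h6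
    nlinarith
  have h9 : d = 0 := by
    have := pow_eq_zero_iff (two_ne_zero) |>.1 (le_antisymm h8 (sq_nonneg _))
    exact norm_eq_zero.1 this
  exact (sub_eq_zero.1 h9).symm

omit hdis in
/-- Weak duality for transport maps. -/
theorem neg_dualPotential_sub_inner_le_cost (hy : Function.Injective y) {lam : RealSpace N}
    {T : RealSpace n → RealSpace n} (hT : IsTransportMap μ X y lam T) (ψ : RealSpace N) :
    -dualPotential μ X y c ψ - inner ℝ lam ψ ≤ ∫ x in X, c x (T x) ∂μ := by
  -- A measurable left inverse of y turns T into an assignment of indices.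
  have hemb : MeasurableEmbedding y :=
    ⟨hy, measurable_of_countable y, fun _ _ => (toFinite _).measurableSet⟩
  obtain ⟨g, hg, hgy⟩ := hemb.exists_measurable_extend (g := id) measurable_id
    (fun _ => ⟨0⟩)
  have hgy' : ∀ i, g (y i) = i := fun i => congrFun hgy i
  have hs : Measurable (g ∘ T) := hg.comp hT.measurable
  have h1 := neg_cost_selection_le_dualPotential hX hc hμX hs ψ
  have h2 : ∫ x in X, c x (y ((g ∘ T) x)) ∂μ = ∫ x in X, c x (T x) ∂μ := by
    refine setIntegral_congr_fun hX.measurableSet fun x hx => ?_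
    obtain ⟨i, hi⟩ := hT.mapsTo hx
    simp only [Function.comp_apply, ← hi, hgy']
  have h3 : ∀ i, μ.real ((g ∘ T) ⁻¹' {i}) = lam i := by
    intro i
    rw [measureReal_def, preimage_comp,
      ← Measure.map_apply hT.measurable (hg (measurableSet_singleton i)), hT.map_eq]
    simp only [Measure.coe_finsetSum, Finset.sum_apply, Measure.smul_apply, smul_eq_mul,
      Measure.dirac_apply' _ (hg (measurableSet_singleton i))]
    rw [Finset.sum_eq_single i]
    · simp [hgy', hT.nonneg i]
    · intro j _ hj
      simp [hgy', hj]
    · simp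
  rw [h2] at h1
  simp only [h3] at h1
  rw [real_inner_eq_sum]
  linarith

omit [NeZero N] hX hc hμX hdis in
theorem IsTransportMap.sum_eq_one {lam : RealSpace N}
    {T : RealSpace n → RealSpace n} (hT : IsTransportMap μ X y lam T) : ∑ i, lam i = 1 := by
  have h : μ.map T univ = 1 := by
    rw [Measure.map_apply hT.measurable MeasurableSet.univ]; simp
  rw [hT.map_eq] at h
  simp only [Measure.coe_finsetSum, Finset.sum_apply, Measure.smul_apply, smul_eq_mul,
    measure_univ, mul_one] at h
  rw [← ENNReal.ofReal_sum_of_nonneg fun i _ => hT.nonneg i, ENNReal.ofReal_eq_one] at h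
  exact h

/-- Sending each point of X to the target of a cell containing it gives equality in weak duality,
with ψ as the dual certificate. -/
theorem exists_isTransportMap_cellMass (ψ : RealSpace N) :
    ∃ T, IsTransportMap μ X y (cellMass μ X y c ψ) T ∧
      ∫ x in X, c x (T x) ∂μ =
        -dualPotential μ X y c ψ - inner ℝ (cellMass μ X y c ψ) ψ := by
  obtain ⟨s, hs, hsψ⟩ := exists_measurable_selection hX hc ψ
  have hG := measureReal_selection hμX (hdis ψ) hX.measurableSet hsψ
  have h2 := neg_cost_selection_eq_dualPotential hX hc hμX hs hsψ
  simp only [hG] at h2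
  refine ⟨y ∘ s, ⟨(measurable_of_countable y).comp hs, fun x _ => mem_range_self _,
    fun i => measureReal_nonneg, ?_⟩, ?_⟩
  · ext A hA
    rw [Measure.map_apply ((measurable_of_countable y).comp hs) hA, preimage_comp,
      ← Measure.map_apply hs (toFinite _).measurableSet]
    conv_lhs => rw [← Measure.sum_smul_dirac (μ.map s)]
    simp only [Measure.sum_fintype, Measure.coe_finsetSum, Finset.sum_apply,
      Measure.smul_apply, smul_eq_mul]
    refine Finset.sum_congr rfl fun i _ => ?_
    rw [Measure.map_apply hs (measurableSet_singleton i), ← hG i, measureReal_def,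
      ENNReal.ofReal_toReal (measure_ne_top _ _), Measure.dirac_apply' _ hA,
      Measure.dirac_apply' _ (toFinite _).measurableSet]
    rfl
  · rw [real_inner_eq_sum]
    simp only [Function.comp_apply]
    linarith

omit hdis in
theorem coe_le_transportCost (hy : Function.Injective y) (lam ψ : RealSpace N) :
    ((-dualPotential μ X y c ψ - inner ℝ lam ψ : ℝ) : EReal) ≤ transportCost μ X y c lam :=
  le_iInf fun T => EReal.coe_le_coe_iff.2
    (neg_dualPotential_sub_inner_le_cost hX hc hμX hy T.2 ψ)

theorem transportCost_cellMass_le (ψ : RealSpace N) :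
    transportCost μ X y c (cellMass μ X y c ψ) ≤
      ((-dualPotential μ X y c ψ - inner ℝ (cellMass μ X y c ψ) ψ : ℝ) : EReal) := by
  obtain ⟨T, hT, h⟩ := exists_isTransportMap_cellMass hX hc hμX hdis ψ
  rw [← h]
  exact iInf_le (fun T : {T : RealSpace n → RealSpace n //
    IsTransportMap μ X y (cellMass μ X y c ψ) T} => ((∫ x in X, c x (T.1 x) ∂μ : ℝ) : EReal))
    ⟨T, hT⟩

/-- A uniformly convex supporting paraboloid of the transport cost at a point of the simplex. -/
theorem exists_supporting_paraboloid (hy : Function.Injective y) {L : ℝ≥0} (hL0 : 0 < L)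
    (hL : LipschitzWith L (cellMass μ X y c))
    {w : RealSpace N} (hw : ∀ i, 0 ≤ w i) (hw1 : ∑ i, w i = 1) :
    ∃ (a : ℝ) (ψ : RealSpace N), transportCost μ X y c w ≤ a ∧ ∀ lam,
      ((a + inner ℝ ψ (w - lam) + 1 / (4 * L) * ‖w - lam‖ ^ 2 : ℝ) : EReal) ≤
        transportCost μ X y c lam := by
  obtain ⟨ψ, hψ⟩ := exists_cellMass_eq hX hc hμX hdis hL0 hL hw hw1
  have hup := transportCost_cellMass_le hX hc hμX hdis ψ
  rw [hψ] at hup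
  refine ⟨_, ψ, hup, fun lam => ?_⟩
  have hLpos : (0 : ℝ) < L := hL0
  -- Test weak duality at λ with ψ shifted by b(w - λ): the gain is (b - Lb²)‖w - λ‖², largest at
  -- this b, where it equals ‖w - λ‖²/(4L).
  set b : ℝ := 1 / (2 * L) with hb
  refine le_trans ?_ (coe_le_transportCost hX hc hμX hy lam (ψ + b • (w - lam)))
  rw [EReal.coe_le_coe_iff]
  have h2 := dualPotential_le hX hc hμX hdis hL ψ (ψ + b • (w - lam))
  rw [hψ, add_sub_cancel_left, inner_smul_right, norm_smul, mul_pow, Real.norm_eq_abs,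
    sq_abs] at h2
  have h3 : inner ℝ w (w - lam) - inner ℝ lam (w - lam) = ‖w - lam‖ ^ 2 := by
    rw [← inner_sub_left, real_inner_self_eq_norm_sq]
  have h4 : inner ℝ ψ (w - lam) = inner ℝ w ψ - inner ℝ lam ψ := by
    rw [inner_sub_right, real_inner_comm w ψ, real_inner_comm lam ψ]
  have h5 : b * ‖w - lam‖ ^ 2 - L * (b ^ 2 * ‖w - lam‖ ^ 2) = 1 / (4 * L) * ‖w - lam‖ ^ 2 := by
    rw [hb]; field_simp; ring
  rw [inner_add_right, inner_smul_right, h4, ← h5]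
  have h6 := congrArg (b * ·) h3
  beta_reduce at h6
  linarith

/-- Uniform convexity of the transport cost. -/
theorem transportCost_convex_combination_add_le (hy : Function.Injective y) {L : ℝ≥0}
    (hL0 : 0 < L) (hL : LipschitzWith L (cellMass μ X y c)) {t : ℝ} (ht0 : 0 ≤ t) (ht1 : t ≤ 1)
    (x z : RealSpace N) :
    transportCost μ X y c (t • x + (1 - t) • z)
        + ((1 / (4 * L) * (t * (1 - t) * ‖z - x‖ ^ 2) : ℝ) : EReal)
      ≤ (t : EReal) * transportCost μ X y c x
        + ((1 - t : ℝ) : EReal) * transportCost μ X y c z := by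
  rcases ht0.eq_or_lt with rfl | ht0
  · simp
  rcases ht1.eq_or_lt with rfl | ht1
  · simp
  have ht1' : 0 < 1 - t := by linarith
  -- In `EReal`, ⊥ + ⊤ = ⊥, so ⊥ has to be excluded before infinite costs can be discarded; weak
  -- duality at ψ = 0 does this.
  have hbot : ∀ v, transportCost μ X y c v ≠ ⊥ := fun v h => by
    have := coe_le_transportCost (μ := μ) hX hc hμX hy v 0
    rw [h, le_bot_iff] at this
    exact EReal.coe_ne_bot _ this
  have hmulbot : ∀ (r : ℝ) v, 0 < r → (r : EReal) * transportCost μ X y c v ≠ ⊥ := by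
    intro r v hr h
    induction hv : transportCost μ X y c v using EReal.rec with
    | bot => exact hbot v hv
    | coe q => rw [hv, ← EReal.coe_mul] at h; exact EReal.coe_ne_bot _ h
    | top => rw [hv, EReal.coe_mul_top_of_pos hr] at h; exact top_ne_bot h
  by_cases hx : transportCost μ X y c x = ⊤
  · rw [hx, EReal.coe_mul_top_of_pos ht0, EReal.top_add_of_ne_bot (hmulbot _ _ ht1')]
    exact le_top
  by_cases hz : transportCost μ X y c z = ⊤
  · rw [hz, EReal.coe_mul_top_of_pos ht1', EReal.add_top_of_ne_bot (hmulbot _ _ ht0)]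
    exact le_top
  have hdom : ∀ v, transportCost μ X y c v ≠ ⊤ → (∀ i, 0 ≤ v i) ∧ ∑ i, v i = 1 := by
    intro v hv
    obtain ⟨T, -⟩ := iInf_lt_top.1 (lt_top_iff_ne_top.2 hv)
    exact ⟨T.2.nonneg, T.2.sum_eq_one⟩
  obtain ⟨hx0, hx1⟩ := hdom x hx
  obtain ⟨hz0, hz1⟩ := hdom z hz
  set w := t • x + (1 - t) • z with hw
  obtain ⟨a, ψ, ha, hψ⟩ := exists_supporting_paraboloid hX hc hμX hdis hy hL0 hL (w := w)
    (fun i => by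
      simp only [hw, PiLp.add_apply, PiLp.smul_apply, smul_eq_mul]
      exact add_nonneg (mul_nonneg ht0.le (hx0 i)) (mul_nonneg ht1'.le (hz0 i)))
    (by
      simp only [hw, PiLp.add_apply, PiLp.smul_apply, smul_eq_mul, Finset.sum_add_distrib,
        ← Finset.mul_sum, hx1, hz1]
      ring)
  have hψx := hψ x
  have hψz := hψ z
  lift transportCost μ X y c x to ℝ using ⟨hx, hbot x⟩ with p
  lift transportCost μ X y c z to ℝ using ⟨hz, hbot z⟩ with q
  rw [EReal.coe_le_coe_iff] at hψx hψz
  refine (add_le_add_left ha _).trans ?_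
  rw [← EReal.coe_mul, ← EReal.coe_mul, ← EReal.coe_add, ← EReal.coe_add, EReal.coe_le_coe_iff]
  have e1 : w - x = (1 - t) • (z - x) := by rw [hw]; module
  have e2 : w - z = -(t • (z - x)) := by rw [hw]; module
  rw [e1, inner_smul_right, norm_smul, mul_pow, Real.norm_eq_abs, sq_abs] at hψx
  rw [e2, inner_neg_right, inner_smul_right, norm_neg, norm_smul, mul_pow, Real.norm_eq_abs,
    sq_abs] at hψz
  -- In the weighted sum the linear terms cancel, w being the barycentre, and t(1-t)² + (1-t)t² =
  -- t(1-t).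
  have f1 := mul_le_mul_of_nonneg_left hψx ht0.le
  have f2 := mul_le_mul_of_nonneg_left hψz ht1'.le
  refine le_trans (le_of_eq ?_) (add_le_add f1 f2)
  ring

/-- Quadratic growth of the transport cost around a minimizer over a convex subset of its domain. -/
theorem transportCost_minimizer_add_le (hy : Function.Injective y) {L : ℝ≥0}
    (hL0 : 0 < L) (hL : LipschitzWith L (cellMass μ X y c)) {K : Set (RealSpace N)}
    {v lam : RealSpace N} (hK : Convex ℝ K) (hfin : ∀ a ∈ K, transportCost μ X y c a < ⊤)
    (hv : v ∈ K) (hmin : ∀ a ∈ K, transportCost μ X y c v ≤ transportCost μ X y c a)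
    (hlam : lam ∈ K) :
    transportCost μ X y c v + ((1 / (8 * L) * ‖lam - v‖ ^ 2 : ℝ) : EReal) ≤
      transportCost μ X y c lam := by
  -- At the midpoint the gain is ‖λ - v‖²/(16L); the midpoint costs at least as much as v, and
  -- doubling gives 1/(8L).
  have h := transportCost_convex_combination_add_le hX hc hμX hdis hy hL0 hL
    (t := 1 / 2) (by norm_num) (by norm_num) v lam
  have hmem : (1 / 2 : ℝ) • v + (1 - 1 / 2 : ℝ) • lam ∈ K :=
    hK hv hlam (by norm_num) (by norm_num) (by norm_num)
  have h := (add_le_add_left (hmin _ hmem) _).trans h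
  have hbot : ∀ a, transportCost μ X y c a ≠ ⊥ := fun a h => by
    have := coe_le_transportCost (μ := μ) hX hc hμX hy a 0
    rw [h, le_bot_iff] at this
    exact EReal.coe_ne_bot _ this
  have hv' := (hfin v hv).ne
  have hl' := (hfin lam hlam).ne
  lift transportCost μ X y c v to ℝ using ⟨hv', hbot v⟩ with p
  lift transportCost μ X y c lam to ℝ using ⟨hl', hbot lam⟩ with q
  rw [← EReal.coe_mul, ← EReal.coe_mul, ← EReal.coe_add, ← EReal.coe_add,
    EReal.coe_le_coe_iff] at h
  rw [← EReal.coe_add, EReal.coe_le_coe_iff]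
  have : 1 / (4 * (L : ℝ)) * (1 / 2 * (1 - 1 / 2) * ‖lam - v‖ ^ 2) =
      1 / (8 * L) * ‖lam - v‖ ^ 2 / 2 := by
    have hLpos : (0 : ℝ) < L := hL0
    field_simp; ring
  rw [this] at h
  linarith

end Duality

/-! ### Bi-Lipschitz parametrizations and Taylor estimates on nonconvex sets. -/

section BiLipschitz

open Filter Topology

variable {E F G : Type*} [NormedAddCommGroup E] [NormedSpace ℝ E] [NormedAddCommGroup F]
  [NormedSpace ℝ F] [NormedAddCommGroup G] [NormedSpace ℝ G]

/-- An injective immersion of a compact convex set has a Lipschitz inverse. -/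
theorem exists_norm_sub_le_mul_of_injOn [FiniteDimensional ℝ E] {e : E → F} {D : Set E}
    (hDc : IsCompact D) (hD : Convex ℝ D) (hu : UniqueDiffOn ℝ D) (he : ContDiffOn ℝ 1 e D)
    (hinj : InjOn e D) (hker : ∀ p ∈ D, Function.Injective (fderivWithin ℝ e D p)) :
    ∃ K : ℝ, 0 ≤ K ∧ ∀ p ∈ D, ∀ q ∈ D, ‖p - q‖ ≤ K * ‖e p - e q‖ := by
  have key : ∃ K : ℝ, 0 ≤ K ∧ ∀ z ∈ D ×ˢ D, ‖z.1 - z.2‖ ≤ K * ‖e z.1 - e z.2‖ := by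
    -- Compactness of D × D localizes the claim. Off the diagonal, ‖e p - e q‖ is locally bounded
    -- below; on it, e is close to its injective derivative.
    refine (hDc.prod hDc).induction_on
      (p := fun S : Set (E × E) =>
        ∃ K : ℝ, 0 ≤ K ∧ ∀ z ∈ S, ‖z.1 - z.2‖ ≤ K * ‖e z.1 - e z.2‖)
      ⟨0, le_rfl, by simp⟩ ?_ ?_ ?_
    · rintro s t hst ⟨K, hK, h⟩
      exact ⟨K, hK, fun z hz => h z (hst hz)⟩
    · rintro s t ⟨K, hK, h⟩ ⟨K', hK', h'⟩
      refine ⟨K + K', by positivity, fun z hz => ?_⟩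
      have := norm_nonneg (e z.1 - e z.2)
      rcases hz with hz | hz
      · nlinarith [h z hz]
      · nlinarith [h' z hz]
    · rintro ⟨p, q⟩ ⟨hp, hq⟩
      simp only at hp hq
      by_cases hpq : p = q
      · subst hpq
        obtain ⟨K, hK, hKA⟩ := (fderivWithin ℝ e D p).toLinearMap.exists_antilipschitzWith
          (LinearMap.ker_eq_bot.2 (hker p hp))
        have hK' : (0 : ℝ) < K := hK
        have hcont := he.continuousOn_fderivWithin hu le_rfl p hp
        -- With this tolerance the linearization error, multiplied by K, is at most ‖a - b‖/2 and
        -- can be absorbed.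
        obtain ⟨δ, hδ, hball⟩ := Metric.continuousWithinAt_iff.1 hcont (1 / (2 * K))
          (by positivity)
        refine ⟨(D ∩ Metric.ball p δ) ×ˢ (D ∩ Metric.ball p δ), ?_, 2 * K, by positivity, ?_⟩
        · rw [nhdsWithin_prod_eq]
          exact prod_mem_prod (inter_mem_nhdsWithin _ (Metric.ball_mem_nhds p hδ))
            (inter_mem_nhdsWithin _ (Metric.ball_mem_nhds p hδ))
        · rintro ⟨a, b⟩ ⟨ha, hb⟩
          simp only at ha hb ⊢
          have h1 := (hD.inter (convex_ball p δ)).norm_image_sub_le_of_norm_hasFDerivWithin_le'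
            (f := e) (f' := fderivWithin ℝ e D) (φ := fderivWithin ℝ e D p) (C := 1 / (2 * K))
            (fun x hx => (((he.differentiableOn one_ne_zero) x hx.1).hasFDerivWithinAt).mono
              inter_subset_left)
            (fun x hx => by
              have := hball hx.1 hx.2
              rw [dist_eq_norm] at this
              exact this.le) hb ha
          have h2 := hKA.le_mul_dist a b
          rw [dist_eq_norm, dist_eq_norm, ← map_sub] at h2
          have h3 : ‖fderivWithin ℝ e D p (a - b)‖ ≤
              ‖e a - e b‖ + ‖e a - e b - fderivWithin ℝ e D p (a - b)‖ := by
            have := norm_sub_le (e a - e b) (e a - e b - fderivWithin ℝ e D p (a - b))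
            rwa [sub_sub_cancel] at this
          have h4 : ‖a - b‖ ≤ K * (‖e a - e b‖ + 1 / (2 * K) * ‖a - b‖) :=
            h2.trans (mul_le_mul_of_nonneg_left (h3.trans (by gcongr)) hK'.le)
          have h5 : K * (‖e a - e b‖ + 1 / (2 * K) * ‖a - b‖) =
              K * ‖e a - e b‖ + ‖a - b‖ / 2 := by field_simp
          linarith
      · have hne : 0 < ‖e p - e q‖ :=
          norm_pos_iff.2 (sub_ne_zero.2 fun h => hpq (hinj hp hq h))
        have hc : ContinuousOn (fun z : E × E => ‖e z.1 - e z.2‖) (D ×ˢ D) :=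
          ((he.continuousOn.comp continuousOn_fst fun z hz => hz.1).sub
            (he.continuousOn.comp continuousOn_snd fun z hz => hz.2)).norm
        have h1 := (hc (p, q) ⟨hp, hq⟩).eventually (lt_mem_nhds (half_lt_self hne))
        have h2 : ∀ᶠ z : E × E in 𝓝[D ×ˢ D] (p, q), ‖z.1 - z.2‖ < ‖p - q‖ + 1 :=
          (((continuous_fst.sub continuous_snd).norm.continuousAt
            (x := (p, q))).eventually (gt_mem_nhds (lt_add_one _))).filter_mono
            nhdsWithin_le_nhds
        refine ⟨_, h1.and h2, (‖p - q‖ + 1) / (‖e p - e q‖ / 2), by positivity, ?_⟩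
        rintro z ⟨hz1, hz2⟩
        calc ‖z.1 - z.2‖ ≤ ‖p - q‖ + 1 := hz2.le
          _ = (‖p - q‖ + 1) / (‖e p - e q‖ / 2) * (‖e p - e q‖ / 2) := by field_simp
          _ ≤ _ := mul_le_mul_of_nonneg_left hz1.le (by positivity)
  obtain ⟨K, hK, h⟩ := key
  exact ⟨K, hK, fun p hp q hq => h (p, q) ⟨hp, hq⟩⟩

theorem HasDerivWithinAt.norm_le_of_norm_sub_le {γ : ℝ → F} {γ' : F} {s : Set ℝ} {t C : ℝ}
    (h : HasDerivWithinAt γ γ' s t) [(𝓝[s \ {t}] t).NeBot]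
    (hC : ∀ u ∈ s, ‖γ u - γ t‖ ≤ C * |u - t|) : ‖γ'‖ ≤ C := by
  refine le_of_tendsto (hasDerivWithinAt_iff_tendsto_slope.1 h).norm ?_
  filter_upwards [self_mem_nhdsWithin] with u hu
  have hne : 0 < |u - t| := abs_pos.2 (sub_ne_zero.2 fun h => hu.2 h)
  rw [slope_def_module, norm_smul, norm_inv, Real.norm_eq_abs, inv_mul_le_iff₀ hne, mul_comm]
  exact hC u hu.1

/-- The mean value inequality along the image under `e` of a segment. -/
theorem norm_comp_sub_le_of_segment {e : E → F} {D : Set E} {X : Set F} {L M : ℝ}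
    (hD : Convex ℝ D) (heL : ∀ p ∈ D, ∀ q ∈ D, ‖e p - e q‖ ≤ L * ‖p - q‖)
    (he : DifferentiableOn ℝ e D) (hmaps : MapsTo e D X)
    {f : F → G} {f' : F → F →L[ℝ] G} (hf : ∀ x ∈ X, HasFDerivWithinAt f (f' x) X x)
    {p q : E} (hp : p ∈ D) (hq : q ∈ D) (hM : ∀ z ∈ segment ℝ p q, ‖f' (e z)‖ ≤ M) :
    ‖f (e q) - f (e p)‖ ≤ M * (L * ‖q - p‖) := by
  have hM0 : 0 ≤ M := (norm_nonneg _).trans (hM p (left_mem_segment ℝ p q))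
  have hseg : MapsTo (AffineMap.lineMap p q) (Icc (0 : ℝ) 1) (segment ℝ p q) := by
    rw [segment_eq_image_lineMap]
    exact mapsTo_image _ _
  have hline : MapsTo (AffineMap.lineMap p q) (Icc (0 : ℝ) 1) D :=
    fun t ht => hD.segment_subset hp hq (hseg ht)
  have hγ : ∀ t ∈ Icc (0 : ℝ) 1, ∃ γ', HasDerivWithinAt (fun t => e (AffineMap.lineMap p q t)) γ'
      (Icc (0 : ℝ) 1) t ∧ ‖γ'‖ ≤ L * ‖q - p‖ := by
    intro t ht
    have h1 : HasDerivWithinAt (fun t => e (AffineMap.lineMap p q t)) _ (Icc (0 : ℝ) 1) t :=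
      HasFDerivWithinAt.comp_hasDerivWithinAt t
        (he _ (hline ht)).hasFDerivWithinAt
        (AffineMap.hasDerivWithinAt_lineMap (a := p) (b := q) (s := Icc (0 : ℝ) 1) (x := t)) hline
    refine ⟨_, h1, ?_⟩
    have : (𝓝[Icc (0 : ℝ) 1 \ {t}] t).NeBot := by
      have := (uniqueDiffWithinAt_iff_accPt.1 (uniqueDiffOn_Icc zero_lt_one t ht))
      rw [accPt_iff_clusterPt, ClusterPt] at this
      rw [nhdsWithin, sdiff_eq, ← inf_principal]
      convert this using 2
      rw [inf_comm]
    refine h1.norm_le_of_norm_sub_le fun u hu => ?_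
    refine (heL _ (hline hu) _ (hline ht)).trans (le_of_eq ?_)
    rw [← dist_eq_norm (AffineMap.lineMap p q u), dist_lineMap_lineMap, Real.dist_eq, dist_comm,
      dist_eq_norm]
    ring
  choose! γ' hγ' hγL using hγ
  have h := norm_image_sub_le_of_norm_deriv_le_segment'
    (f := fun t : ℝ => f (e (AffineMap.lineMap p q t))) (a := 0) (b := 1)
    (f' := fun t => f' (e (AffineMap.lineMap p q t)) (γ' t)) (C := M * (L * ‖q - p‖))
    (fun t ht => HasFDerivWithinAt.comp_hasDerivWithinAt t (hf _ (hmaps (hline ht)))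
      (hγ' t ht) fun u hu => hmaps (hline hu))
    (fun t ht => ((f' _).le_opNorm _).trans <| by
      have ht' : t ∈ Icc (0 : ℝ) 1 := Ico_subset_Icc_self ht
      exact mul_le_mul (hM _ (hseg ht')) (hγL t ht') (norm_nonneg _) hM0)
    1 (right_mem_Icc.2 zero_le_one)
  simpa using h

/-- If the derivative of `f` is `M`-Lipschitz along images of segments, then `f` is close to its
linearization at a point of `X`, uniformly near that point. -/
theorem abs_sub_sub_le_of_biLipschitz {e : E → F} {e' : F → E} {D : Set E} {X : Set F} {L M r : ℝ}
    (hD : Convex ℝ D) (hL : 0 ≤ L) (hM0 : 0 ≤ M)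
    (heL : ∀ p ∈ D, ∀ q ∈ D, ‖e p - e q‖ ≤ L * ‖p - q‖)
    (heL' : ∀ x ∈ X, ∀ z ∈ X, ‖e' x - e' z‖ ≤ L * ‖x - z‖)
    (he : DifferentiableOn ℝ e D) (hmaps : MapsTo e D X) (hmaps' : MapsTo e' X D)
    (hinv : ∀ x ∈ X, e (e' x) = x)
    {f : F → ℝ} {f' : F → F →L[ℝ] ℝ} {f'' : F → F →L[ℝ] (F →L[ℝ] ℝ)}
    (hf : ∀ x ∈ X, HasFDerivWithinAt f (f' x) X x)
    (hf' : ∀ x ∈ X, HasFDerivWithinAt f' (f'' x) X x) (hM : ∀ x ∈ X, ‖f'' x‖ ≤ M)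
    {x₀ x z : F} (hx₀ : x₀ ∈ X) (hx : x ∈ X) (hz : z ∈ X) (hxr : ‖x - x₀‖ ≤ r)
    (hzr : ‖z - x₀‖ ≤ r) :
    |f z - f x - f' x₀ (z - x)| ≤ M * L ^ 4 * (2 * L ^ 2 + 1) * r * ‖z - x‖ := by
  -- One factor L pulls the points back to D, the other bounds the speed of the image curve, so `f'`
  -- is ML²-Lipschitz.
  have hlip : ∀ a ∈ X, ∀ b ∈ X, ‖f' b - f' a‖ ≤ M * (L * (L * ‖b - a‖)) := by
    intro a ha b hb
    have h := norm_comp_sub_le_of_segment hD heL he hmaps hf' (hmaps' ha) (hmaps' hb)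
      (M := M) fun w hw => hM _ (hmaps (hD.segment_subset (hmaps' ha) (hmaps' hb) hw))
    rw [hinv a ha, hinv b hb] at h
    exact h.trans (by have := heL' b hb a ha; gcongr)
  have hzx : ‖z - x‖ ≤ 2 * r := by
    have := norm_sub_le (z - x₀) (x - x₀)
    rw [sub_sub_sub_cancel_right] at this
    linarith
  have h := norm_comp_sub_le_of_segment hD heL he hmaps
    (f := fun a => f a - f' x₀ a) (f' := fun a => f' a - f' x₀)
    (fun a ha => (hf a ha).sub (f' x₀).hasFDerivWithinAt) (hmaps' hx) (hmaps' hz)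
    (M := M * (L * (L * ((2 * L ^ 2 + 1) * r)))) fun w hw => by
      have hwD := hD.segment_subset (hmaps' hx) (hmaps' hz) hw
      refine (hlip _ hx₀ _ (hmaps hwD)).trans ?_
      have h1 : ‖e w - x‖ ≤ L * (L * ‖z - x‖) := by
        have h2 := heL w hwD _ (hmaps' hx)
        rw [hinv x hx] at h2
        have h3 : ‖w - e' x‖ ≤ ‖e' z - e' x‖ := by
          obtain ⟨t, ht, rfl⟩ := (segment_eq_image_lineMap ℝ (e' x) (e' z)) ▸ hw
          rw [← dist_eq_norm, dist_lineMap_left, dist_comm (e' x), dist_eq_norm, Real.norm_eq_abs,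
            abs_of_nonneg ht.1]
          exact mul_le_of_le_one_left (norm_nonneg _) ht.2
        have h4 := h3.trans (heL' z hz x hx)
        exact h2.trans (by gcongr)
      -- The curve from x to z strays at most L²‖z - x‖ ≤ 2L²r from x, and x is within r of x₀.
      have h5 : ‖e w - x₀‖ ≤ (2 * L ^ 2 + 1) * r := by
        have h6 := norm_add_le (e w - x) (x - x₀)
        rw [sub_add_sub_cancel] at h6
        have h7 : L * (L * ‖z - x‖) ≤ L * (L * (2 * r)) := by gcongr
        calc _ ≤ L * (L * (2 * r)) + r := by linarith
          _ = _ := by ring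
      gcongr
  rw [hinv x hx, hinv z hz, Real.norm_eq_abs] at h
  have h8 := heL' z hz x hx
  have hr : 0 ≤ r := (norm_nonneg _).trans hxr
  calc |f z - f x - f' x₀ (z - x)| = |f z - f' x₀ z - (f x - f' x₀ x)| := by
        rw [map_sub]; congr 1; ring
    _ ≤ _ := h
    _ ≤ M * (L * (L * ((2 * L ^ 2 + 1) * r))) * (L * (L * ‖z - x‖)) := by gcongr
    _ = _ := by ring

end BiLipschitz

/-! ### Volume of the region between two level sets. -/

section Slab

/-- A subset of a ball no two points of which lie at distance parameter `h` or more along a line in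
direction `u` has volume at most proportional to `h`. -/
theorem measure_le_of_translates_disjoint {E : Type*} [NormedAddCommGroup E] [NormedSpace ℝ E]
    [FiniteDimensional ℝ E] [MeasurableSpace E] [BorelSpace E] (ν : Measure E)
    [ν.IsAddHaarMeasure] {A : Set E} (hA : MeasurableSet A) {x u : E} {r h : ℝ} (hr : 0 < r)
    (hh : 0 < h) (hu : ‖u‖ ≤ 1) (hAr : A ⊆ Metric.closedBall x r)
    (hAu : ∀ a ∈ A, ∀ s, h ≤ s → a + s • u ∉ A) :
    ν A ≤ ENNReal.ofReal (2 * h / r) * ν (Metric.closedBall 0 (2 * r)) := by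
  rw [← Measure.addHaar_closedBall_center ν x]
  rcases lt_or_ge r h with hrh | hhr
  · have h1 : (1 : ℝ≥0∞) ≤ ENNReal.ofReal (2 * h / r) := by
      rw [ENNReal.one_le_ofReal, le_div_iff₀ hr]; linarith
    calc ν A ≤ ν (Metric.closedBall x (2 * r)) :=
          measure_mono (hAr.trans (Metric.closedBall_subset_closedBall (by linarith)))
      _ = 1 * ν (Metric.closedBall x (2 * r)) := (one_mul _).symm
      _ ≤ _ := by gcongr
  -- The m translates of A by multiples of h along u are disjoint and lie in the ball of radius 2r,
  -- so m ν(A) is at most its measure; and 1/m ≤ 2h/r.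
  set m := ⌊r / h⌋₊ with hm
  have hm1 : 1 ≤ m := Nat.le_floor (by rw [Nat.cast_one, le_div_iff₀ hh]; linarith)
  have hmr : m * h ≤ r := by
    rw [← le_div_iff₀ hh]; exact Nat.floor_le (by positivity)
  have hm2 : r < 2 * m * h := by
    have h1 : r / h < m + 1 := Nat.lt_floor_add_one _
    have h2 : (1 : ℝ) ≤ m := by exact_mod_cast hm1
    rw [div_lt_iff₀ hh] at h1
    nlinarith
  have hsum : ∑ k ∈ Finset.range m, ν ((fun z => z + -((k * h) • u)) ⁻¹' A) ≤
      ν (Metric.closedBall x (2 * r)) := by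
    rw [← measure_biUnion_finset]
    · refine measure_mono (iUnion₂_subset fun k hk z hz => ?_)
      have hz := hAr hz
      have hkm : (k : ℝ) ≤ m := by exact_mod_cast (Finset.mem_range.1 hk).le
      rw [Metric.mem_closedBall, dist_eq_norm] at hz ⊢
      have h1 : ‖((k : ℝ) * h) • u‖ ≤ r := by
        rw [norm_smul, Real.norm_eq_abs, abs_of_nonneg (by positivity)]
        calc (k : ℝ) * h * ‖u‖ ≤ k * h * 1 := by gcongr
          _ ≤ m * h := by rw [mul_one]; gcongr
          _ ≤ r := hmr
      have h2 := norm_add_le (z + -(((k : ℝ) * h) • u) - x) (((k : ℝ) * h) • u)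
      have h3 : z + -(((k : ℝ) * h) • u) - x + ((k : ℝ) * h) • u = z - x := by abel
      rw [h3] at h2
      linarith
    · have key : ∀ k l : ℕ, k < l → Disjoint ((fun z => z + -(((k : ℝ) * h) • u)) ⁻¹' A)
          ((fun z => z + -(((l : ℝ) * h) • u)) ⁻¹' A) := by
        intro k l hkl
        refine disjoint_left.2 fun z hzk hzl => ?_
        have h1 : (k : ℝ) + 1 ≤ l := by exact_mod_cast hkl
        refine hAu _ hzl ((l - k) * h) (by nlinarith) ?_
        have : z + -(((l : ℝ) * h) • u) + (((l : ℝ) - k) * h) • u =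
          z + -(((k : ℝ) * h) • u) := by module
        rw [this]
        exact hzk
      intro k _ l _ hkl
      rcases lt_or_gt_of_ne hkl with h | h
      · exact key k l h
      · exact (key l k h).symm
    · exact fun k _ => (measurable_add_const _) hA
  simp only [measure_preimage_add_right, Finset.sum_const, Finset.card_range, nsmul_eq_mul]
    at hsum
  have h1 : (1 : ℝ≥0∞) ≤ ENNReal.ofReal (2 * h / r) * m := by
    rw [← ENNReal.ofReal_natCast m, ← ENNReal.ofReal_mul (by positivity), ENNReal.one_le_ofReal,
      div_mul_eq_mul_div, le_div_iff₀ hr]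
    linarith
  calc ν A = 1 * ν A := (one_mul _).symm
    _ ≤ ENNReal.ofReal (2 * h / r) * m * ν A := by gcongr
    _ = ENNReal.ofReal (2 * h / r) * (m * ν A) := mul_assoc _ _ _
    _ ≤ _ := by gcongr

/-- The volume of `{a ≤ f ≤ a + δ}` is at most proportional to `δ`, with a constant that depends
only on the dimension, on a bound `L` for the size and the bi-Lipschitz constants of a convex
parametrization of `X`, a bound `M` for the second derivative of `f` and a lower bound `ε` for its
first derivative. -/
theorem exists_volume_slab_le (n : ℕ) (L M ε : ℝ) (hL : 0 ≤ L) (hM0 : 0 ≤ M) (hε : 0 < ε) :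
    ∃ K : ℝ, 0 ≤ K ∧ ∀ (X D : Set (RealSpace n)) (e e' : RealSpace n → RealSpace n)
      (f : RealSpace n → ℝ) (f' : RealSpace n → RealSpace n →L[ℝ] ℝ)
      (f'' : RealSpace n → RealSpace n →L[ℝ] (RealSpace n →L[ℝ] ℝ)),
      IsCompact X → Convex ℝ D → (∀ x ∈ X, ‖x‖ ≤ L) →
      (∀ p ∈ D, ∀ q ∈ D, ‖e p - e q‖ ≤ L * ‖p - q‖) →
      (∀ x ∈ X, ∀ z ∈ X, ‖e' x - e' z‖ ≤ L * ‖x - z‖) →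
      DifferentiableOn ℝ e D → MapsTo e D X → MapsTo e' X D → (∀ x ∈ X, e (e' x) = x) →
      (∀ x ∈ X, HasFDerivWithinAt f (f' x) X x) →
      (∀ x ∈ X, HasFDerivWithinAt f' (f'' x) X x) → (∀ x ∈ X, ‖f'' x‖ ≤ M) →
      (∀ x ∈ X, ε ≤ ‖f' x‖) →
      ∀ a δ : ℝ, 0 < δ →
        volume {x | x ∈ X ∧ a ≤ f x ∧ f x ≤ a + δ} ≤ ENNReal.ofReal (K * δ) := by
  set B := M * L ^ 4 * (2 * L ^ 2 + 1) with hB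
  have hB0 : 0 ≤ B := by positivity
  -- Two points of a ball of radius r are within 2r of each other; at that scale the derivative of f
  -- deviates by at most ε/2.
  set r := ε / (4 * (B + 1)) with hr
  have hr0 : 0 < r := by positivity
  have hBr : B * (2 * r) ≤ ε / 2 := by
    have : ε / 2 - B * (2 * r) = 2 * r := by rw [hr]; field_simp; ring
    linarith
  -- Covering the ball of radius L, not X itself, keeps the number of small balls independent of X.
  obtain ⟨t, ht, hcover⟩ := Metric.totallyBounded_iff.1
    (isCompact_closedBall (0 : RealSpace n) L).totallyBounded r hr0
  lift t to Finset (RealSpace n) using ht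
  set V := volume (Metric.closedBall (0 : RealSpace n) (2 * r)) with hV
  have hVtop : V ≠ ⊤ := (isCompact_closedBall (0 : RealSpace n) (2 * r)).measure_lt_top.ne
  refine ⟨t.card * (8 / (ε * r)) * V.toReal, by positivity, ?_⟩
  intro X D e e' f f' f'' hX hD hXL heL heL' he hmaps hmaps' hinv hf hf' hM hε' a δ hδ
  set S := {x | x ∈ X ∧ a ≤ f x ∧ f x ≤ a + δ} with hS
  have hSc : IsClosed S :=
    ContinuousOn.preimage_isClosed_of_isClosed (fun x hx => (hf x hx).continuousWithinAt)
      hX.isClosed (isClosed_Icc (a := a) (b := a + δ))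
  have hloc : ∀ y ∈ t, volume (S ∩ Metric.closedBall y r) ≤
      ENNReal.ofReal (2 * (4 * δ / ε) / r) * V := by
    intro y _
    by_cases hne : (S ∩ Metric.closedBall y r).Nonempty
    · obtain ⟨x₀, hx₀, hx₀y⟩ := hne
      have hx₀X := hx₀.1
      set g := (InnerProductSpace.toDual ℝ (RealSpace n)).symm (f' x₀) with hg
      have hgn : ‖g‖ = ‖f' x₀‖ := LinearIsometryEquiv.norm_map _ _
      have hg0 : 0 < ‖g‖ := by rw [hgn]; exact hε.trans_le (hε' x₀ hx₀X)
      set u := ‖g‖⁻¹ • g with hu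
      have hu1 : ‖u‖ = 1 := by
        rw [hu, norm_smul, norm_inv, norm_norm, inv_mul_cancel₀ hg0.ne']
      have hfu : f' x₀ u = ‖g‖ := by
        rw [← InnerProductSpace.toDual_symm_apply, ← hg, hu, inner_smul_right,
          real_inner_self_eq_norm_sq]
        field_simp
      -- Along u, f grows at rate at least ε - ε/2, so a shift s ≥ 4δ/ε raises it by at least 2δ and
      -- leaves the slab.
      refine measure_le_of_translates_disjoint volume
        (hSc.measurableSet.inter Metric.isClosed_closedBall.measurableSet) hr0 (by positivity)
        hu1.le inter_subset_right ?_
      rintro x ⟨hx, hxy⟩ s hs ⟨hz, hzy⟩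
      have hs0 : 0 < s := lt_of_lt_of_le (by positivity) hs
      have hclose : ∀ w, w ∈ Metric.closedBall y r → ‖w - x₀‖ ≤ 2 * r := by
        intro w hw
        rw [← dist_eq_norm]
        have := dist_triangle_right w x₀ y
        rw [Metric.mem_closedBall] at hw hx₀y
        linarith
      have h1 := abs_sub_sub_le_of_biLipschitz hD hL hM0 heL heL' he hmaps hmaps' hinv hf hf' hM
        hx₀X hx.1 hz.1 (hclose x hxy) (hclose _ hzy)
      rw [add_sub_cancel_left, map_smul, smul_eq_mul, hfu, norm_smul, hu1, mul_one,
        Real.norm_eq_abs, abs_of_pos hs0, ← hB, mul_assoc] at h1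
      have h1' := (abs_le.1 h1).1
      have h2 : ε ≤ ‖g‖ := hgn ▸ hε' x₀ hx₀X
      have h3 : B * (2 * r * s) ≤ ε / 2 * s := by nlinarith
      have h4 : s * ε ≤ s * ‖g‖ := by gcongr
      have h5 : f (x + s • u) - f x ≤ δ := by linarith [hz.2.2, hx.2.1]
      have h6 : 4 * δ ≤ s * ε := by rwa [div_le_iff₀ hε] at hs
      linarith
    · rw [not_nonempty_iff_eq_empty.1 hne, measure_empty]
      exact zero_le
  have hSt : S ⊆ ⋃ y ∈ t, S ∩ Metric.closedBall y r := by
    intro x hx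
    obtain ⟨y, hy, hxy⟩ := mem_iUnion₂.1 (hcover (mem_closedBall_zero_iff.2 (hXL x hx.1)))
    exact mem_iUnion₂.2 ⟨y, hy, hx, Metric.ball_subset_closedBall hxy⟩
  calc volume S ≤ ∑ y ∈ t, volume (S ∩ Metric.closedBall y r) :=
        (measure_mono hSt).trans (measure_biUnion_finset_le _ _)
    _ ≤ ∑ _y ∈ t, ENNReal.ofReal (2 * (4 * δ / ε) / r) * V := Finset.sum_le_sum hloc
    _ = ENNReal.ofReal (t.card * (8 / (ε * r)) * V.toReal * δ) := by
      rw [Finset.sum_const, nsmul_eq_mul, ← ENNReal.ofReal_natCast,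
        ← ENNReal.ofReal_toReal hVtop, ENNReal.toReal_ofReal ENNReal.toReal_nonneg,
        ← ENNReal.ofReal_mul (by positivity), ← ENNReal.ofReal_mul (by positivity)]
      congr 1
      field_simp
      ring

end Slab

/-! ### Regularity of the coordinate domains and maps. -/

section Diffeo

variable {n : ℕ} {e e' : RealSpace n → RealSpace n} {D X : Set (RealSpace n)}

theorem IsC2Diffeo.image_eq (h : IsC2Diffeo e e' D X) : e '' D = X :=
  h.mapsTo.image_subset.antisymm fun x hx => ⟨e' x, h.mapsTo_inv hx, h.invOn.2 hx⟩

theorem IsC2Diffeo.image_inv_eq (h : IsC2Diffeo e e' D X) : e' '' X = D :=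
  h.mapsTo_inv.image_subset.antisymm fun p hp => ⟨e p, h.mapsTo hp, h.invOn.1 hp⟩

theorem IsC2Diffeo.isCompact (h : IsC2Diffeo e e' D X) (hX : IsCompact X) : IsCompact D := by
  rw [← h.image_inv_eq]
  exact hX.image_of_continuousOn h.contDiffOn_inv.continuousOn

/-- A convex D with empty interior lies in its null frontier; its differentiable image X would be
null too. -/
theorem IsC2Diffeo.uniqueDiffOn_domain (h : IsC2Diffeo e e' D X) (hD : Convex ℝ D)
    (hX : volume X ≠ 0) : UniqueDiffOn ℝ D := by
  refine uniqueDiffOn_convex hD ?_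
  by_contra hne
  rw [not_nonempty_iff_eq_empty] at hne
  refine hX ?_
  rw [← h.image_eq]
  refine addHaar_image_eq_zero_of_differentiableOn_of_addHaar_eq_zero volume
    (h.contDiffOn.differentiableOn two_ne_zero) ?_
  refine measure_mono_null (subset_closure.trans ?_) (hD.addHaar_frontier volume)
  rw [frontier, hne, sdiff_empty]

theorem IsC2Diffeo.injective_fderivWithin (h : IsC2Diffeo e e' D X) (hu : UniqueDiffOn ℝ D)
    {p : RealSpace n} (hp : p ∈ D) : Function.Injective (fderivWithin ℝ e D p) := by
  have h1 : HasFDerivWithinAt e (fderivWithin ℝ e D p) D p :=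
    (h.contDiffOn.differentiableOn two_ne_zero p hp).hasFDerivWithinAt
  have h2 : HasFDerivWithinAt e' (fderivWithin ℝ e' X (e p)) X (e p) :=
    (h.contDiffOn_inv.differentiableOn two_ne_zero _ (h.mapsTo hp)).hasFDerivWithinAt
  have h3 : HasFDerivWithinAt (e' ∘ e) (ContinuousLinearMap.id ℝ (RealSpace n)) D p :=
    (hasFDerivWithinAt_id p D).congr (fun q hq => h.invOn.1 hq) (h.invOn.1 hp)
  have h4 := (hu p hp).eq (h2.comp p h1 h.mapsTo) h3
  intro a b hab
  have h5 : ∀ v, fderivWithin ℝ e' X (e p) (fderivWithin ℝ e D p v) = v := fun v =>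
    congrArg (fun A : RealSpace n →L[ℝ] RealSpace n => A v) h4
  rw [← h5 a, hab, h5 b]

/-- Tangent directions are carried over by the invertible derivative of e. This makes derivatives
within X unique, so those of the costs can be manipulated. -/
theorem IsC2Diffeo.uniqueDiffOn_range (h : IsC2Diffeo e e' D X) (hu : UniqueDiffOn ℝ D) :
    UniqueDiffOn ℝ X := by
  rw [← h.image_eq]
  rintro _ ⟨p, hp, rfl⟩
  refine (h.contDiffOn.differentiableOn two_ne_zero p hp).hasFDerivWithinAt.uniqueDiffWithinAt
    (hu p hp) (Function.Surjective.denseRange ?_)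
  exact LinearMap.injective_iff_surjective.1 (h.injective_fderivWithin hu hp)

theorem IsC2Diffeo.exists_lipschitz (h : IsC2Diffeo e e' D X) (hX : IsCompact X)
    (hD : Convex ℝ D) (hu : UniqueDiffOn ℝ D) :
    ∃ K : ℝ, 0 ≤ K ∧ ∀ p ∈ D, ∀ q ∈ D, ‖e p - e q‖ ≤ K * ‖p - q‖ := by
  obtain ⟨K, hK⟩ := (h.isCompact hX).exists_bound_of_continuousOn
    (h.contDiffOn.continuousOn_fderivWithin hu one_le_two)
  refine ⟨max K 0, le_max_right _ _, fun p hp q hq => ?_⟩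
  exact hD.norm_image_sub_le_of_norm_fderivWithin_le
    (h.contDiffOn.differentiableOn two_ne_zero) (fun x hx => (hK x hx).trans (le_max_left _ _))
    hq hp

theorem IsC2Diffeo.exists_lipschitz_inv (h : IsC2Diffeo e e' D X) (hX : IsCompact X)
    (hD : Convex ℝ D) (hu : UniqueDiffOn ℝ D) :
    ∃ K : ℝ, 0 ≤ K ∧ ∀ x ∈ X, ∀ z ∈ X, ‖e' x - e' z‖ ≤ K * ‖x - z‖ := by
  obtain ⟨K, hK, hKe⟩ := exists_norm_sub_le_mul_of_injOn (h.isCompact hX) hD hu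
    (h.contDiffOn.of_le one_le_two) h.invOn.1.injOn fun p hp => h.injective_fderivWithin hu hp
  refine ⟨K, hK, fun x hx z hz => ?_⟩
  have := hKe _ (h.mapsTo_inv hx) _ (h.mapsTo_inv hz)
  rwa [h.invOn.2 hx, h.invOn.2 hz] at this

end Diffeo

/-! ### Finiteness of the extended norms, and the estimates they encode. -/

section Norms

variable {n : ℕ}

theorem iSup_enorm_ne_top_of_isCompact {A : Set (RealSpace n)} {F : Type*}
    [NormedAddCommGroup F] {f : RealSpace n → F} (hA : IsCompact A) (hf : ContinuousOn f A) :
    ⨆ x ∈ A, ‖f x‖ₑ ≠ ⊤ := by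
  obtain ⟨K, hK⟩ := hA.exists_bound_of_continuousOn hf
  refine ne_top_of_le_ne_top (ENNReal.ofReal_ne_top (r := K)) (iSup₂_le fun x hx => ?_)
  rw [← ofReal_norm]
  exact ENNReal.ofReal_le_ofReal (hK x hx)

theorem norm_le_toReal_of_enorm_le {F : Type*} [NormedAddCommGroup F] {v : F} {b : ℝ≥0∞}
    (h : ‖v‖ₑ ≤ b) (hb : b ≠ ⊤) : ‖v‖ ≤ b.toReal := by
  rw [← toReal_enorm]
  exact ENNReal.toReal_mono hb h

theorem holderNormOn_ne_top {F : Type} [NormedAddCommGroup F] {α : ℝ≥0} {f : RealSpace n → F}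
    {A : Set (RealSpace n)} (hA : IsCompact A) (hα : 0 < α)
    (hf : ∃ K : ℝ≥0, HolderOnWith K α f A) : holderNormOn α f A ≠ ⊤ := by
  obtain ⟨K, hK⟩ := hf
  refine ENNReal.add_ne_top.2 ⟨iSup_enorm_ne_top_of_isCompact hA (hK.continuousOn hα), ?_⟩
  exact eHolderNorm_ne_top.2 ⟨K, HolderWith.restrict_iff.2 hK⟩

theorem holderOnWith_one_of_norm_sub_le {F : Type} [NormedAddCommGroup F] {f : RealSpace n → F}
    {A : Set (RealSpace n)} {K : ℝ} (hK : 0 ≤ K)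
    (hf : ∀ p ∈ A, ∀ q ∈ A, ‖f p - f q‖ ≤ K * ‖p - q‖) :
    ∃ K : ℝ≥0, HolderOnWith K 1 f A := by
  refine ⟨⟨K, hK⟩, holderOnWith_one.2 (LipschitzOnWith.of_dist_le_mul fun p hp q hq => ?_)⟩
  rw [dist_eq_norm, dist_eq_norm]
  exact hf p hp q hq

theorem norm_le_of_holderNormOn_le {F : Type} [NormedAddCommGroup F] {α : ℝ≥0}
    {f : RealSpace n → F} {A : Set (RealSpace n)} {b : ℝ≥0∞} (h : holderNormOn α f A ≤ b)
    (hb : b ≠ ⊤) {x : RealSpace n} (hx : x ∈ A) : ‖f x‖ ≤ b.toReal :=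
  norm_le_toReal_of_enorm_le ((le_iSup₂ (f := fun x (_ : x ∈ A) => ‖f x‖ₑ) x hx).trans
    (le_self_add.trans h)) hb

theorem norm_sub_le_of_holderNormOn_one_le {F : Type} [NormedAddCommGroup F]
    {f : RealSpace n → F} {A : Set (RealSpace n)} {b : ℝ≥0∞} (h : holderNormOn 1 f A ≤ b)
    (hb : b ≠ ⊤) {p q : RealSpace n} (hp : p ∈ A) (hq : q ∈ A) :
    ‖f p - f q‖ ≤ b.toReal * ‖p - q‖ := by
  have h1 : eHolderNorm 1 (A.domRestrict f) ≤ b := le_add_self.trans h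
  have h2 : MemHolder 1 (A.domRestrict f) := eHolderNorm_ne_top.1 (ne_top_of_le_ne_top hb h1)
  have h3 := h2.holderWith.dist_le ⟨p, hp⟩ ⟨q, hq⟩
  rw [NNReal.coe_one, Real.rpow_one] at h3
  change dist (f p) (f q) ≤ _ * dist p q at h3
  rw [dist_eq_norm, dist_eq_norm] at h3
  refine h3.trans (mul_le_mul_of_nonneg_right ?_ (norm_nonneg _))
  exact ENNReal.toReal_mono hb h1

theorem c2Norm_ne_top {f : RealSpace n → ℝ} {X : Set (RealSpace n)} (hX : IsCompact X)
    (hu : UniqueDiffOn ℝ X) (hf : ContDiffOn ℝ 2 f X) : c2Norm f X ≠ ⊤ := by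
  refine ENNReal.sum_ne_top.2 fun k hk => iSup_enorm_ne_top_of_isCompact hX
    (hf.continuousOn_iteratedFDerivWithin ?_ hu)
  have : k ≤ 2 := Nat.lt_succ_iff.1 (Finset.mem_range.1 hk)
  exact_mod_cast this

theorem norm_fderivWithin_fderivWithin_le {f : RealSpace n → ℝ} {X : Set (RealSpace n)}
    (hu : UniqueDiffOn ℝ X) {b : ℝ≥0∞} (h : c2Norm f X ≤ b) (hb : b ≠ ⊤) {x : RealSpace n}
    (hx : x ∈ X) : ‖fderivWithin ℝ (fderivWithin ℝ f X) X x‖ ≤ b.toReal := by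
  rw [← norm_iteratedFDerivWithin_one _ (hu x hx), norm_iteratedFDerivWithin_fderivWithin hu hx]
  refine norm_le_toReal_of_enorm_le ((le_iSup₂ (f := fun x (_ : x ∈ X) =>
    ‖iteratedFDerivWithin ℝ 2 f X x‖ₑ) x hx).trans (le_trans ?_ h)) hb
  exact Finset.single_le_sum (f := fun k => ⨆ x ∈ X, ‖iteratedFDerivWithin ℝ k f X x‖ₑ)
    (fun _ _ => zero_le) (Finset.mem_range.2 (by norm_num : 2 < 3))

end Norms

/-! ### From strips to the Lipschitz bound on cell masses. -/

section Lipschitz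

variable {n N : ℕ} {μ : Measure (RealSpace n)} {X : Set (RealSpace n)} {y : Fin N → RealSpace n}
  {c : RealSpace n → RealSpace n → ℝ}

theorem continuousOn_costGradient (hu : UniqueDiffOn ℝ X)
    {i : Fin N} (hc : ContDiffOn ℝ 2 (fun x => c x (y i)) X) :
    ContinuousOn (costGradient X y c i) X :=
  (InnerProductSpace.toDual ℝ (RealSpace n)).symm.continuous.comp_continuousOn
    (hc.continuousOn_fderivWithin hu one_le_two)

theorem norm_costGradient_sub (i j : Fin N) (x : RealSpace n) :
    ‖costGradient X y c i x - costGradient X y c j x‖ =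
      ‖fderivWithin ℝ (fun z => c z (y i)) X x - fderivWithin ℝ (fun z => c z (y j)) X x‖ := by
  rw [costGradient, costGradient, gradientWithin, gradientWithin, ← map_sub]
  exact LinearIsometryEquiv.norm_map _ _

/-- The `μ`-measure of a strip between two level sets of a difference of costs is at most
proportional to the width of the strip. -/
def StripBound (μ : Measure (RealSpace n)) (X : Set (RealSpace n)) (y : Fin N → RealSpace n)
    (c : RealSpace n → RealSpace n → ℝ) (K : ℝ) : Prop :=
  ∀ i j, i ≠ j → ∀ a δ : ℝ, 0 < δ →
    μ {x | x ∈ X ∧ a ≤ c x (y i) - c x (y j) ∧ c x (y i) - c x (y j) ≤ a + δ} ≤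
      ENNReal.ofReal (K * δ)

/-- An overlap of two cells lies in a level set of the cost difference, hence in strips of every
width δ; let δ → 0. -/
theorem StripBound.cellsAEDisjoint {K : ℝ} (h : StripBound μ X y c K) :
    CellsAEDisjoint μ X y c := by
  intro ψ i j hij
  have h1 : ∀ δ : ℝ, 0 < δ →
      μ (laguerreCell X y c ψ i ∩ laguerreCell X y c ψ j) ≤ ENNReal.ofReal (K * δ) := by
    refine fun δ hδ => (measure_mono ?_).trans (h i j hij (ψ j - ψ i) δ hδ)
    rintro x ⟨⟨hx, hi⟩, -, hj⟩
    exact ⟨hx, by linarith, by linarith⟩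
  have h2 : Filter.Tendsto (fun δ : ℝ => ENNReal.ofReal (K * δ)) (nhdsWithin 0 (Ioi 0))
      (nhds 0) := by
    have : Continuous fun δ : ℝ => ENNReal.ofReal (K * δ) :=
      ENNReal.continuous_ofReal.comp (continuous_const.mul continuous_id)
    have := (this.tendsto 0).mono_left (nhdsWithin_le_nhds (s := Ioi 0))
    simpa using this
  exact le_antisymm (ge_of_tendsto h2 (Filter.eventually_of_mem self_mem_nhdsWithin h1))
    zero_le

theorem StripBound.lipschitzWith_cellMass [NeZero N] [IsFiniteMeasure μ] {K : ℝ} (hK : 0 ≤ K)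
    (h : StripBound μ X y c K) {C : ℝ≥0} (hC : 2 * N * K ≤ C) :
    LipschitzWith (C * N) (cellMass μ X y c) := by
  have key : ∀ (ψ ψ' : RealSpace N) (i : Fin N), ψ ≠ ψ' →
      μ.real (laguerreCell X y c ψ i) ≤
        μ.real (laguerreCell X y c ψ' i) + N * (K * (2 * ‖ψ - ψ'‖)) := by
    intro ψ ψ' i hne
    -- A point in cell i for ψ that prefers j under ψ' has c(·, y_i) - c(·, y_j) between ψ'^j - ψ'^i
    -- and ψ^j - ψ^i; these differ by at most δ.
    set δ := 2 * ‖ψ - ψ'‖ with hδ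
    have hδ0 : 0 < δ := by
      have := norm_pos_iff.2 (sub_ne_zero.2 hne)
      positivity
    set S : Fin N → Set (RealSpace n) := fun j => if i = j then ∅ else
      {x | x ∈ X ∧ ψ' j - ψ' i ≤ c x (y i) - c x (y j) ∧
        c x (y i) - c x (y j) ≤ ψ' j - ψ' i + δ} with hS
    have hSj : ∀ j, μ.real (S j) ≤ K * δ := by
      intro j
      by_cases hij : i = j
      · simp only [hS, hij, if_true, measureReal_empty]
        positivity
      · simp only [hS, hij, if_false]
        exact ENNReal.toReal_le_of_le_ofReal (by positivity) (h i j hij _ _ hδ0)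
    have hsub : laguerreCell X y c ψ i ⊆ laguerreCell X y c ψ' i ∪ ⋃ j ∈ Finset.univ, S j := by
      rintro x ⟨hx, hxi⟩
      by_cases hmem : x ∈ laguerreCell X y c ψ' i
      · exact Or.inl hmem
      · right
        obtain ⟨j, hj⟩ := exists_eq_cStarTransform (y := y) (c := c) ψ' x
        have h1 : -c x (y i) - ψ' i < -c x (y j) - ψ' j := by
          rw [hj]
          exact lt_of_le_of_ne (neg_cost_sub_le_cStarTransform ψ' x i) fun h => hmem ⟨hx, h⟩
        have h2 := neg_cost_sub_le_cStarTransform (y := y) (c := c) ψ x j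
        rw [← hxi] at h2
        have hij : i ≠ j := by rintro rfl; exact lt_irrefl _ h1
        refine mem_iUnion₂.2 ⟨j, Finset.mem_univ j, ?_⟩
        simp only [hS, hij, if_false]
        have h3 := (abs_le.1 (PiLp.norm_apply_le (ψ - ψ') i)).1
        have h4 := (abs_le.1 (PiLp.norm_apply_le (ψ - ψ') j)).2
        simp only [PiLp.sub_apply] at h3 h4
        exact ⟨hx, by linarith, by linarith⟩
    calc μ.real (laguerreCell X y c ψ i)
        ≤ μ.real (laguerreCell X y c ψ' i ∪ ⋃ j ∈ Finset.univ, S j) := measureReal_mono hsub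
      _ ≤ μ.real (laguerreCell X y c ψ' i) + μ.real (⋃ j ∈ Finset.univ, S j) :=
        measureReal_union_le _ _
      _ ≤ μ.real (laguerreCell X y c ψ' i) + ∑ j, μ.real (S j) := by
        gcongr; exact measureReal_biUnion_finset_le _ _
      _ ≤ μ.real (laguerreCell X y c ψ' i) + ∑ _j : Fin N, K * δ := by
        gcongr with j; exact hSj j
      _ = _ := by simp
  refine LipschitzWith.of_dist_le_mul fun ψ ψ' => ?_
  rcases eq_or_ne ψ ψ' with rfl | hne
  · simp
  rw [dist_eq_norm, dist_eq_norm]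
  set b := N * (K * (2 * ‖ψ - ψ'‖)) with hb
  have hb0 : 0 ≤ b := by positivity
  have hcomp : ∀ i, |(cellMass μ X y c ψ - cellMass μ X y c ψ') i| ≤ b := by
    intro i
    change |μ.real (laguerreCell X y c ψ i) - μ.real (laguerreCell X y c ψ' i)| ≤ b
    have h1 := key ψ ψ' i hne
    have h2 := key ψ' ψ i hne.symm
    rw [norm_sub_rev] at h2
    exact abs_le.2 ⟨by linarith, by linarith⟩
  have hN : (1 : ℝ) ≤ N := by exact_mod_cast NeZero.one_le
  -- The factor √N is rounded up to N, to match the form C·N of the Lipschitz constant.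
  have h1 : ‖cellMass μ X y c ψ - cellMass μ X y c ψ'‖ ≤ N * b := by
    refine abs_le_of_sq_le_sq' ?_ (by positivity) |>.2
    rw [EuclideanSpace.norm_sq_eq]
    calc _ ≤ ∑ _i : Fin N, b ^ 2 := by
          refine Finset.sum_le_sum fun i _ => ?_
          rw [Real.norm_eq_abs]
          exact pow_le_pow_left₀ (abs_nonneg _) (hcomp i) 2
      _ = N * b ^ 2 := by simp
      _ ≤ (N * b) ^ 2 := by nlinarith [sq_nonneg b, mul_nonneg (sub_nonneg.2 hN) (sq_nonneg b)]
  refine h1.trans ?_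
  push_cast
  calc N * b = 2 * N * K * N * ‖ψ - ψ'‖ := by rw [hb]; ring
    _ ≤ _ := by gcongr

end Lipschitz

/-! ### Admissible data and universality of the constants. -/

section Assembly

variable {n N : ℕ} {α : ℝ≥0} {μ : Measure (RealSpace n)} {X : Set (RealSpace n)}
  {y : Fin N → RealSpace n} {c : RealSpace n → RealSpace n → ℝ} {D : Fin N → Set (RealSpace n)}
  {e e' : Fin N → RealSpace n → RealSpace n} {ρ : RealSpace n → ℝ}

/-- The standing assumptions on the domain, the cost and the source measure. -/
structure IsAdmissible (α : ℝ≥0) (X : Set (RealSpace n)) (y : Fin N → RealSpace n)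
    (c : RealSpace n → RealSpace n → ℝ) (D : Fin N → Set (RealSpace n))
    (e e' : Fin N → RealSpace n → RealSpace n) (ρ : RealSpace n → ℝ)
    (μ : Measure (RealSpace n)) : Prop where
  isCompact : IsCompact X
  contDiffOn : ∀ i, ContDiffOn ℝ 2 (fun x => c x (y i)) X
  twist : ∀ x ∈ X, ∀ i k, i ≠ k → costGradient X y c i x ≠ costGradient X y c k x
  convex : ∀ i, Convex ℝ (D i)
  diffeo : ∀ i, IsC2Diffeo (e i) (e' i) (D i) X
  nonneg : ∀ x ∈ X, 0 ≤ ρ x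
  holder : ∃ K : ℝ≥0, HolderOnWith K α ρ X
  eq_withDensity : μ = (volume.restrict X).withDensity (fun x => ENNReal.ofReal (ρ x))
  isProbabilityMeasure : IsProbabilityMeasure μ

namespace IsAdmissible

variable (h : IsAdmissible α X y c D e e' ρ μ)

include h

theorem restrict_eq : μ.restrict X = μ := by
  rw [h.eq_withDensity, restrict_withDensity h.isCompact.measurableSet,
    Measure.restrict_restrict h.isCompact.measurableSet, inter_self]

theorem volume_ne_zero : volume X ≠ 0 := by
  intro h0
  have := h.isProbabilityMeasure
  refine IsProbabilityMeasure.ne_zero μ ?_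
  rw [h.eq_withDensity, Measure.restrict_eq_zero.2 h0, withDensity_zero_left]

theorem nonempty : X.Nonempty := by
  rw [nonempty_iff_ne_empty]
  rintro rfl
  exact h.volume_ne_zero measure_empty

theorem injective : Function.Injective y := by
  intro i k hik
  by_contra hne
  obtain ⟨x, hx⟩ := h.nonempty
  refine h.twist x hx i k hne ?_
  rw [costGradient, costGradient, hik]

theorem uniqueDiffOn_domain (i : Fin N) : UniqueDiffOn ℝ (D i) :=
  (h.diffeo i).uniqueDiffOn_domain (h.convex i) h.volume_ne_zero

theorem uniqueDiffOn [NeZero N] : UniqueDiffOn ℝ X :=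
  (h.diffeo 0).uniqueDiffOn_range (h.uniqueDiffOn_domain 0)

theorem rhoNorm_ne_top (hα : 0 < α) : (universalQuantities α X y c D e e' ρ).rhoNorm ≠ ⊤ :=
  holderNormOn_ne_top h.isCompact hα h.holder

theorem costNorm_ne_top [NeZero N] : (universalQuantities α X y c D e e' ρ).costNorm ≠ ⊤ := by
  change ⨆ i, c2Norm (fun x => c x (y i)) X ≠ ⊤
  obtain ⟨i, hi⟩ := exists_eq_ciSup_of_finite (f := fun i => c2Norm (fun x => c x (y i)) X)
  rw [← hi]
  exact c2Norm_ne_top h.isCompact h.uniqueDiffOn (h.contDiffOn i)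

theorem expLip_ne_top [NeZero N] : (universalQuantities α X y c D e e' ρ).expLip ≠ ⊤ := by
  change ⨆ i, max (holderNormOn 1 (e i) (D i)) (holderNormOn 1 (e' i) X) ≠ ⊤
  obtain ⟨i, hi⟩ := exists_eq_ciSup_of_finite
    (f := fun i => max (holderNormOn 1 (e i) (D i)) (holderNormOn 1 (e' i) X))
  rw [← hi]
  refine (max_lt ?_ ?_).ne
  · obtain ⟨K, hK, hKe⟩ := (h.diffeo i).exists_lipschitz h.isCompact (h.convex i)
      (h.uniqueDiffOn_domain i)
    exact (holderNormOn_ne_top ((h.diffeo i).isCompact h.isCompact) one_pos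
      (holderOnWith_one_of_norm_sub_le hK hKe)).lt_top
  · obtain ⟨K, hK, hKe⟩ := (h.diffeo i).exists_lipschitz_inv h.isCompact (h.convex i)
      (h.uniqueDiffOn_domain i)
    exact (holderNormOn_ne_top h.isCompact one_pos
      (holderOnWith_one_of_norm_sub_le hK hKe)).lt_top

/-- The pointwise twist condition becomes uniform by compactness of X and finiteness of the set of
pairs. -/
theorem epsTwist_ne_zero [NeZero N] :
    (universalQuantities α X y c D e e' ρ).epsTwist ≠ 0 := by
  have key : ∀ i j, ∃ κ : ℝ, 0 < κ ∧ (i ≠ j → ∀ x ∈ X,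
      κ ≤ ‖costGradient X y c i x - costGradient X y c j x‖) := by
    intro i j
    by_cases hij : i = j
    · exact ⟨1, one_pos, fun h => absurd hij h⟩
    obtain ⟨x, hx, hmin⟩ := h.isCompact.exists_isMinOn h.nonempty
      ((continuousOn_costGradient h.uniqueDiffOn (h.contDiffOn i)).sub
        (continuousOn_costGradient h.uniqueDiffOn (h.contDiffOn j))).norm
    exact ⟨_, norm_pos_iff.2 (sub_ne_zero.2 (h.twist x hx i j hij)), fun _ z hz => hmin hz⟩
  choose κ hκ hκle using key
  obtain ⟨p, hp⟩ := Finite.exists_min fun p : Fin N × Fin N => κ p.1 p.2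
  have hpos : 0 < ENNReal.ofReal (κ p.1 p.2) := ENNReal.ofReal_pos.2 (hκ _ _)
  refine (hpos.trans_le ?_).ne'
  refine le_iInf₂ fun x hx => le_iInf fun i => le_iInf fun j => le_iInf fun hij => ?_
  rw [← ofReal_norm]
  exact ENNReal.ofReal_le_ofReal ((hp (i, j)).trans (hκle i j hij x hx))

omit h in
theorem epsTwist_toReal_le (i j : Fin N) (hij : i ≠ j) {x : RealSpace n} (hx : x ∈ X) :
    (universalQuantities α X y c D e e' ρ).epsTwist.toReal ≤
      ‖costGradient X y c i x - costGradient X y c j x‖ := by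
  rw [← toReal_enorm]
  exact ENNReal.toReal_mono enorm_ne_top
    (iInf₂_le_of_le x hx (iInf_le_of_le i (iInf_le_of_le j (iInf_le_of_le hij le_rfl))))

theorem epsTwist_ne_top (i j : Fin N) (hij : i ≠ j) :
    (universalQuantities α X y c D e e' ρ).epsTwist ≠ ⊤ := by
  obtain ⟨x, hx⟩ := h.nonempty
  exact ne_top_of_le_ne_top (enorm_ne_top (x := costGradient X y c i x - costGradient X y c j x))
    (iInf₂_le_of_le x hx (iInf_le_of_le i (iInf_le_of_le j (iInf_le_of_le hij le_rfl))))

theorem measure_le (hα : 0 < α) {A : Set (RealSpace n)} (hA : MeasurableSet A) (hAX : A ⊆ X) :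
    μ A ≤ ENNReal.ofReal (universalQuantities α X y c D e e' ρ).rhoNorm.toReal * volume A := by
  rw [h.eq_withDensity, withDensity_apply _ hA, Measure.restrict_restrict hA,
    inter_eq_left.2 hAX, ← setLIntegral_const]
  refine setLIntegral_mono' hA fun x hx => ENNReal.ofReal_le_ofReal ?_
  exact (le_abs_self _).trans
    (norm_le_of_holderNormOn_le (f := ρ) (b := (universalQuantities α X y c D e e' ρ).rhoNorm)
      le_rfl (h.rhoNorm_ne_top hα) (hAX hx))

end IsAdmissible

/-- The strip bound holds with a universal constant. -/
theorem exists_universal_stripBound (n N : ℕ) [NeZero N] (α : ℝ≥0) (hα : 0 < α)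
    (q : UniversalQuantities) :
    ∃ K : ℝ, 0 ≤ K ∧ ∀ (X : Set (RealSpace n)) (y : Fin N → RealSpace n)
      (c : RealSpace n → RealSpace n → ℝ) (D : Fin N → Set (RealSpace n))
      (e e' : Fin N → RealSpace n → RealSpace n) (ρ : RealSpace n → ℝ)
      (μ : Measure (RealSpace n)), IsAdmissible α X y c D e e' ρ μ →
      universalQuantities α X y c D e e' ρ = q → StripBound μ X y c K := by
  -- Any admissible problem with two distinct indices passes this test. For N = 1 the infimum is
  -- empty, equal to ⊤ with `toReal` 0, and the strip bound is vacuous.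
  by_cases hq : 0 < q.epsTwist.toReal
  swap
  · refine ⟨0, le_rfl, fun X y c D e e' ρ μ h hqe i j hij => ?_⟩
    subst hqe
    exact absurd (ENNReal.toReal_pos h.epsTwist_ne_zero (h.epsTwist_ne_top i j hij)) hq
  obtain ⟨K, hK, hslab⟩ := exists_volume_slab_le n q.expLip.toReal
    (q.costNorm.toReal + q.costNorm.toReal) q.epsTwist.toReal ENNReal.toReal_nonneg
    (add_nonneg ENNReal.toReal_nonneg ENNReal.toReal_nonneg) hq
  refine ⟨q.rhoNorm.toReal * K, mul_nonneg ENNReal.toReal_nonneg hK, ?_⟩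
  intro X y c D e e' ρ μ h hqe i j hij a δ hδ
  have hlip : max (holderNormOn 1 (e i) (D i)) (holderNormOn 1 (e' i) X) ≤ q.expLip := by
    rw [← hqe]
    exact le_iSup (fun i => max (holderNormOn 1 (e i) (D i)) (holderNormOn 1 (e' i) X)) i
  have hltop : q.expLip ≠ ⊤ := hqe ▸ h.expLip_ne_top
  have hcn : ∀ k, c2Norm (fun x => c x (y k)) X ≤ q.costNorm := by
    intro k
    rw [← hqe]
    exact le_iSup (fun k => c2Norm (fun x => c x (y k)) X) k
  have hctop : q.costNorm ≠ ⊤ := hqe ▸ h.costNorm_ne_top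
  have hu := h.uniqueDiffOn
  have hdiff : ∀ k, ∀ x ∈ X, HasFDerivWithinAt (fun z => c z (y k))
      (fderivWithin ℝ (fun z => c z (y k)) X x) X x := fun k x hx =>
    ((h.contDiffOn k).differentiableOn two_ne_zero x hx).hasFDerivWithinAt
  have hdiff' : ∀ k, ∀ x ∈ X, HasFDerivWithinAt (fderivWithin ℝ (fun z => c z (y k)) X)
      (fderivWithin ℝ (fderivWithin ℝ (fun z => c z (y k)) X) X x) X x := fun k x hx =>
    (((h.contDiffOn k).fderivWithin hu (m := 1) (by norm_num)).differentiableOn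
      one_ne_zero x hx).hasFDerivWithinAt
  have hvol := hslab X (D i) (e i) (e' i) (fun x => c x (y i) - c x (y j))
    (fun x => fderivWithin ℝ (fun z => c z (y i)) X x - fderivWithin ℝ (fun z => c z (y j)) X x)
    (fun x => fderivWithin ℝ (fderivWithin ℝ (fun z => c z (y i)) X) X x -
      fderivWithin ℝ (fderivWithin ℝ (fun z => c z (y j)) X) X x)
    h.isCompact (h.convex i)
    -- Since x = e(e' x), the supremum part of the norm of e bounds X.
    (fun x hx => by
      have := norm_le_of_holderNormOn_le ((le_max_left _ _).trans hlip) hltop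
        ((h.diffeo i).mapsTo_inv hx)
      rwa [(h.diffeo i).invOn.2 hx] at this)
    (fun p hp r hr => norm_sub_le_of_holderNormOn_one_le ((le_max_left _ _).trans hlip) hltop
      hp hr)
    (fun p hp r hr => norm_sub_le_of_holderNormOn_one_le ((le_max_right _ _).trans hlip) hltop
      hp hr)
    ((h.diffeo i).contDiffOn.differentiableOn two_ne_zero) (h.diffeo i).mapsTo
    (h.diffeo i).mapsTo_inv (fun x hx => (h.diffeo i).invOn.2 hx)
    (fun x hx => (hdiff i x hx).sub (hdiff j x hx))
    (fun x hx => (hdiff' i x hx).sub (hdiff' j x hx))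
    (fun x hx => (norm_sub_le (fderivWithin ℝ (fderivWithin ℝ (fun z => c z (y i)) X) X x)
      (fderivWithin ℝ (fderivWithin ℝ (fun z => c z (y j)) X) X x)).trans (add_le_add
      (norm_fderivWithin_fderivWithin_le hu (hcn i) hctop hx)
      (norm_fderivWithin_fderivWithin_le hu (hcn j) hctop hx)))
    (fun x hx => by
      rw [← norm_costGradient_sub, ← hqe]
      exact IsAdmissible.epsTwist_toReal_le i j hij hx)
    a δ hδ
  have hmeas : MeasurableSet
      {x | x ∈ X ∧ a ≤ c x (y i) - c x (y j) ∧ c x (y i) - c x (y j) ≤ a + δ} :=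
    (ContinuousOn.preimage_isClosed_of_isClosed
      ((h.contDiffOn i).continuousOn.sub (h.contDiffOn j).continuousOn)
      h.isCompact.isClosed (isClosed_Icc (a := a) (b := a + δ))).measurableSet
  refine (h.measure_le hα hmeas fun x hx => hx.1).trans ?_
  rw [hqe, mul_assoc, ENNReal.ofReal_mul ENNReal.toReal_nonneg]
  gcongr

end Assembly

theorem lemmaA1 (n N : ℕ) (hn : 2 ≤ n) (hN : 1 ≤ N) (α : ℝ≥0) (hα : 0 < α) (hα1 : α ≤ 1) :
    -- the universal constant, a function of the admitted quantities only
    ∃ CL : UniversalQuantities → ℝ≥0, (∀ q, 0 < CL q) ∧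
      ∀ (X : Set (RealSpace n)) (y : Fin N → RealSpace n) (c : RealSpace n → RealSpace n → ℝ)
        (D : Fin N → Set (RealSpace n)) (e e' : Fin N → RealSpace n → RealSpace n)
        (ρ : RealSpace n → ℝ) (μ : Measure (RealSpace n)),
        IsCompact X →
        -- the cost is `C²` in `x` and satisfies the twist condition
        (∀ i, ContDiffOn ℝ 2 (fun x => c x (y i)) X) →
        (∀ x ∈ X, ∀ i k, i ≠ k → costGradient X y c i x ≠ costGradient X y c k x) →
        -- `X` is convex in each of the coordinate systems `e i`
        (∀ i, Convex ℝ (D i)) →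
        (∀ i, IsC2Diffeo (e i) (e' i) (D i) X) →
        -- `μ` is a probability measure on `X` with a Hölder continuous density
        (∀ x ∈ X, 0 ≤ ρ x) →
        (∃ K : ℝ≥0, HolderOnWith K α ρ X) →
        μ = (volume.restrict X).withDensity (fun x => ENNReal.ofReal (ρ x)) →
        IsProbabilityMeasure μ →
        LipschitzWith (CL (universalQuantities α X y c D e e' ρ) * N) (cellMass μ X y c) ∧
        ∀ C : ℝ≥0, 0 < C → LipschitzWith (C * N) (cellMass μ X y c) →
          -- strong convexity
          (∀ (t : ℝ) (x z : RealSpace N), 0 ≤ t → t ≤ 1 →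
            transportCost μ X y c (t • x + (1 - t) • z)
                + ((1 / (8 * C * N) * t * (1 - t) * ‖z - x‖ ^ 2 : ℝ) : EReal)
              ≤ (t : EReal) * transportCost μ X y c x
                + ((1 - t : ℝ) : EReal) * transportCost μ X y c z) ∧
          -- quadratic growth around a minimizer over a convex subset of the domain
          (∀ (K : Set (RealSpace N)) (lamMin lam : RealSpace N), Convex ℝ K →
            (∀ a ∈ K, transportCost μ X y c a < ⊤) →
            lamMin ∈ K → (∀ a ∈ K, transportCost μ X y c lamMin ≤ transportCost μ X y c a) →
            lam ∈ K →
            transportCost μ X y c lamMin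
                + ((1 / (32 * C * N) * ‖lam - lamMin‖ ^ 2 : ℝ) : EReal)
              ≤ transportCost μ X y c lam) := by
  have : NeZero N := ⟨by omega⟩
  choose K hK hstrip using exists_universal_stripBound n N α hα
  -- The summand 1 only secures positivity.
  refine ⟨fun q => (2 * N * K q).toNNReal + 1,
    fun q => add_pos_of_nonneg_of_pos zero_le one_pos, ?_⟩
  intro X y c D e e' ρ μ hX hc htw hD he hρ hρK hμ hprob
  have h : IsAdmissible α X y c D e e' ρ μ := ⟨hX, hc, htw, hD, he, hρ, hρK, hμ, hprob⟩
  have hs := hstrip _ X y c D e e' ρ μ h rfl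
  refine ⟨hs.lipschitzWith_cellMass (hK _) ?_, fun C hC hL => ?_⟩
  · exact (Real.le_coe_toNNReal _).trans (NNReal.coe_le_coe.2 le_self_add)
  have hcc : ∀ i, ContinuousOn (fun x => c x (y i)) X := fun i => (hc i).continuousOn
  have hdis := hs.cellsAEDisjoint
  have hNpos : (0 : ℝ≥0) < N := by exact_mod_cast hN
  have hL0 : 0 < C * N := mul_pos hC hNpos
  have hCN : (0 : ℝ) < C * N := by exact_mod_cast hL0
  refine ⟨fun t x z ht0 ht1 => ?_, fun K lamMin lam hKc hfin hmem hmin hlam => ?_⟩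
  · refine le_trans (add_le_add_right ?_ _) (transportCost_convex_combination_add_le hX hcc
      h.restrict_eq hdis h.injective hL0 hL ht0 ht1 x z)
    rw [EReal.coe_le_coe_iff, NNReal.coe_mul, NNReal.coe_natCast, mul_assoc (_ * t), mul_assoc,
      mul_assoc (8 : ℝ), mul_assoc t]
    have h1 : 0 ≤ t * ((1 - t) * ‖z - x‖ ^ 2) :=
      mul_nonneg ht0 (mul_nonneg (by linarith) (sq_nonneg _))
    refine mul_le_mul_of_nonneg_right ?_ h1
    exact one_div_le_one_div_of_le (by positivity) (by linarith)
  · refine le_trans (add_le_add_right ?_ _) (transportCost_minimizer_add_le hX hcc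
      h.restrict_eq hdis h.injective hL0 hL hKc hfin hmem hmin hlam)
    rw [EReal.coe_le_coe_iff, NNReal.coe_mul, NNReal.coe_natCast, mul_assoc (32 : ℝ)]
    refine mul_le_mul_of_nonneg_right ?_ (sq_nonneg _)
    exact one_div_le_one_div_of_le (by positivity) (by linarith)
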